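/- **Theorem (averaged implicit SGD).** Let $\nu$ be a $\sigma$-finite measure on $\mathbb{R}^d$ and let $\{f(y;x,\theta):\theta\in\mathbb{R}^p\}$ be a jointly measurable family of conditional probability densities, with respect to $\nu$, of an outcome $Y\in\mathbb{R}^d$ given a covariate $X\in\mathbb{R}^p$, all the densities having the same support. Let $\theta_\star\in\mathbb{R}^p$, and let $(X_n,Y_n)$, $n\ge1$, be i.i.d. copies of $(X,Y)$, where $X$ has an arbitrary law and $Y$ given $X$ has density $f(\cdot;X,\theta_\star)$. Write $\nabla,\nabla^2$ for derivatives in $\theta$ and assume: 1. almost surely, $\theta\mapsto\log f(Y;X,\theta)$ is concave and twice differentiable on $\mathbb{R}^p$, and its gradient is Lipschitz continuous with a constant $L_0$; 2. there is $\underline{\lambda_f}>0$ such that, almost surely, $-\nabla^2\log f(Y;X,\theta)\succeq\underline{\lambda_f}I$ for all $\theta\in\mathbb{R}^p$; 3. the usual regularity conditions hold at $\theta_\star$: $\nabla\log f(Y;X,\theta_\star)$ is square integrable with mean $0$; the Fisher information $\mathcal{I}(\theta_\star)=\mathbb{E}[\nabla\log f(Y;X,\theta_\star)\,\nabla\log f(Y;X,\theta_\star)^{\top}]$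 equals $\mathbb{E}[-\nabla^2\log f(Y;X,\theta_\star)]$ (the latter being integrable); and on a neighbourhood of $\theta_\star$, almost surely, $\log f(Y;X,\cdot)$ is three times differentiable with third derivative bounded by an integrable function of $(X,Y)$. Let $\gamma_n=\gamma_1n^{-\gamma}$ with $\gamma_1>0$ and $\gamma\in[1/2,1)$, let $\theta_0$ be square integrable and independent of the data, and let the random vectors $\theta_n$ satisfy, almost surely, $$\theta_n=\theta_{n-1}+\gamma_n\nabla\log f(Y_n;X_n,\theta_n),\qquad \bar\theta_n=\frac1n\sum_{i=1}^n\theta_i,\qquad n\ge1 .$$ Then $\bar\theta_n\to\theta_\star$ in probability, and $\bar\theta_n$ is asymptotically efficient: $\bar\theta_n$ is square integrable, $\mathcal{I}(\theta_\star)$ is invertible, and the covariance matrices satisfy $$n\,\mathrm{Var}(\bar\theta_n)\longrightarrow\mathcal{I}(\theta_\star)^{-1}.$$ -/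

import Mathlib

open MeasureTheory ProbabilityTheory Filter Topology
open scoped NNReal ENNReal

noncomputable section

/-- The log-likelihood `θ ↦ log f(y; x, θ)` of one data point `z = (x, y)`.  The arguments of the
density `f` are the outcome `y`, the covariate `x` and the parameter `θ`, in this order. -/
def logLik {p d : ℕ}
    (f : EuclideanSpace ℝ (Fin d) → EuclideanSpace ℝ (Fin p) → EuclideanSpace ℝ (Fin p) → ℝ)
    (z : EuclideanSpace ℝ (Fin p) × EuclideanSpace ℝ (Fin d))
    (θ : EuclideanSpace ℝ (Fin p)) : ℝ :=
  Real.log (f z.2 z.1 θ)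

/-- The score `∇ log f(y; x, θ)`, the gradient with respect to `θ`. -/
def score {p d : ℕ}
    (f : EuclideanSpace ℝ (Fin d) → EuclideanSpace ℝ (Fin p) → EuclideanSpace ℝ (Fin p) → ℝ)
    (z : EuclideanSpace ℝ (Fin p) × EuclideanSpace ℝ (Fin d))
    (θ : EuclideanSpace ℝ (Fin p)) : EuclideanSpace ℝ (Fin p) :=
  gradient (logLik f z) θ

/-- The observed Fisher information matrix `-∇² log f(y; x, θ)` of one data point. -/
def observedInfo {p d : ℕ}
    (f : EuclideanSpace ℝ (Fin d) → EuclideanSpace ℝ (Fin p) → EuclideanSpace ℝ (Fin p) → ℝ)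
    (z : EuclideanSpace ℝ (Fin p) × EuclideanSpace ℝ (Fin d))
    (θ : EuclideanSpace ℝ (Fin p)) : Matrix (Fin p) (Fin p) ℝ :=
  Matrix.of fun j k => -(fderiv ℝ (score f z) θ (EuclideanSpace.single k 1)) j

/-- The law of a data point `(X, Y)`: the covariate `X` has law `μX` and, given `X = x`, the outcome
`Y` has density `f(·; x, θ)` with respect to the dominating measure `ν`. -/
def dataLaw {p d : ℕ} (μX : Measure (EuclideanSpace ℝ (Fin p)))
    (ν : Measure (EuclideanSpace ℝ (Fin d)))
    (f : EuclideanSpace ℝ (Fin d) → EuclideanSpace ℝ (Fin p) → EuclideanSpace ℝ (Fin p) → ℝ)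
    (θ : EuclideanSpace ℝ (Fin p)) :
    Measure (EuclideanSpace ℝ (Fin p) × EuclideanSpace ℝ (Fin d)) :=
  (μX.prod ν).withDensity fun z => ENNReal.ofReal (f z.2 z.1 θ)

/-- The expected Fisher information matrix `I(θ) = 𝔼[∇ log f(Y; X, θ) ∇ log f(Y; X, θ)ᵀ]`, where
`(X, Y)` follows the model with parameter `θ`. -/
def fisherInfo {p d : ℕ} (μX : Measure (EuclideanSpace ℝ (Fin p)))
    (ν : Measure (EuclideanSpace ℝ (Fin d)))
    (f : EuclideanSpace ℝ (Fin d) → EuclideanSpace ℝ (Fin p) → EuclideanSpace ℝ (Fin p) → ℝ)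
    (θ : EuclideanSpace ℝ (Fin p)) : Matrix (Fin p) (Fin p) ℝ :=
  Matrix.of fun j k => ∫ z, score f z θ j * score f z θ k ∂(dataLaw μX ν f θ)

/-- `f(·; x, θ)` is a family of conditional probability densities of `Y` given `X = x` with respect
to `ν`, and all the members of the family have the same support. -/
structure IsDensityFamily {p d : ℕ} (μX : Measure (EuclideanSpace ℝ (Fin p)))
    (ν : Measure (EuclideanSpace ℝ (Fin d)))
    (f : EuclideanSpace ℝ (Fin d) → EuclideanSpace ℝ (Fin p) → EuclideanSpace ℝ (Fin p) → ℝ) :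
    Prop where
  measurable : Measurable
    fun q : (EuclideanSpace ℝ (Fin p) × EuclideanSpace ℝ (Fin d)) × EuclideanSpace ℝ (Fin p) =>
      f q.1.2 q.1.1 q.2
  nonneg : ∀ y x θ, 0 ≤ f y x θ
  lintegral_eq_one : ∀ θ, ∀ᵐ x ∂μX, ∫⁻ y, ENNReal.ofReal (f y x θ) ∂ν = 1
  common_support : ∀ᵐ z ∂(μX.prod ν), ∀ θ θ', 0 < f z.2 z.1 θ → 0 < f z.2 z.1 θ'

/-- Almost surely, the log-likelihood of a data point is concave and twice differentiable in the
parameter, and its gradient is Lipschitz continuous with constant `L₀`. -/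
structure IsSmoothConcave {p d : ℕ}
    (Q : Measure (EuclideanSpace ℝ (Fin p) × EuclideanSpace ℝ (Fin d)))
    (f : EuclideanSpace ℝ (Fin d) → EuclideanSpace ℝ (Fin p) → EuclideanSpace ℝ (Fin p) → ℝ)
    (L₀ : ℝ≥0) : Prop where
  concave : ∀ᵐ z ∂Q, ConcaveOn ℝ Set.univ (logLik f z)
  differentiable : ∀ᵐ z ∂Q, Differentiable ℝ (logLik f z)
  differentiable_score : ∀ᵐ z ∂Q, Differentiable ℝ (score f z)
  lipschitz_score : ∀ᵐ z ∂Q, LipschitzWith L₀ (score f z)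

/-- The usual regularity conditions of likelihood theory at the true parameter `θs`: the score at
`θs` is centred, the Fisher information is finite and equal to the expected observed information,
and near `θs` the log-likelihood has third derivatives with an integrable bound. -/
structure IsRegularAt {p d : ℕ} (μX : Measure (EuclideanSpace ℝ (Fin p)))
    (ν : Measure (EuclideanSpace ℝ (Fin d)))
    (f : EuclideanSpace ℝ (Fin d) → EuclideanSpace ℝ (Fin p) → EuclideanSpace ℝ (Fin p) → ℝ)
    (θs : EuclideanSpace ℝ (Fin p)) : Prop where
  memLp_score : MemLp (fun z => score f z θs) 2 (dataLaw μX ν f θs)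
  integral_score : ∫ z, score f z θs ∂(dataLaw μX ν f θs) = 0
  integrable_observedInfo : ∀ j k,
    Integrable (fun z => observedInfo f z θs j k) (dataLaw μX ν f θs)
  integral_observedInfo : ∀ j k,
    ∫ z, observedInfo f z θs j k ∂(dataLaw μX ν f θs) = fisherInfo μX ν f θs j k
  third_derivative :
    ∃ U : Set (EuclideanSpace ℝ (Fin p)), IsOpen U ∧ θs ∈ U ∧
      ∃ M : EuclideanSpace ℝ (Fin p) × EuclideanSpace ℝ (Fin d) → ℝ,
        Integrable M (dataLaw μX ν f θs) ∧
        ∀ᵐ z ∂(dataLaw μX ν f θs), ∀ θ ∈ U,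
          DifferentiableAt ℝ (fderiv ℝ (score f z)) θ ∧
          ‖fderiv ℝ (fderiv ℝ (score f z)) θ‖ ≤ M z

/-- The random vectors `θ n`, `n ≥ 0`, are iterates of implicit stochastic gradient ascent on the
log-likelihood with learning rates `γ₁ n ^ (-γ)`: almost surely, for every `n ≥ 1`,
`θₙ = θₙ₋₁ + γ₁ n ^ (-γ) ∇ log f(Yₙ; Xₙ, θₙ)`. -/
structure IsImplicitSGD {Ω : Type*} [MeasurableSpace Ω] {p d : ℕ} (P : Measure Ω)
    (f : EuclideanSpace ℝ (Fin d) → EuclideanSpace ℝ (Fin p) → EuclideanSpace ℝ (Fin p) → ℝ)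
    (γ₁ γ : ℝ) (X : ℕ → Ω → EuclideanSpace ℝ (Fin p)) (Y : ℕ → Ω → EuclideanSpace ℝ (Fin d))
    (θ : ℕ → Ω → EuclideanSpace ℝ (Fin p)) : Prop where
  measurable : ∀ n, Measurable (θ n)
  update : ∀ n : ℕ, ∀ᵐ ω ∂P,
    θ (n + 1) ω = θ n ω +
      (γ₁ * ((n + 1 : ℕ) : ℝ) ^ (-γ)) • score f (X (n + 1) ω, Y (n + 1) ω) (θ (n + 1) ω)

/-- The averaged iterate `(1 / n) ∑_{i = 1}^n θᵢ`, for `n ≥ 1`. -/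
def averagedIterate {Ω : Type*} {p : ℕ} (θ : ℕ → Ω → EuclideanSpace ℝ (Fin p)) (n : ℕ) (ω : Ω) :
    EuclideanSpace ℝ (Fin p) :=
  (n : ℝ)⁻¹ • ∑ i ∈ Finset.Icc 1 n, θ i ω

/-- The variance (covariance matrix) of a random vector. -/
def varianceMatrix {Ω : Type*} [MeasurableSpace Ω] {p : ℕ} (P : Measure Ω)
    (V : Ω → EuclideanSpace ℝ (Fin p)) : Matrix (Fin p) (Fin p) ℝ :=
  Matrix.of fun j k => covariance (fun ω => V ω j) (fun ω => V ω k) P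

end

/-!
The error `e n = θ n - θs` of the implicit iterates obeys `e (n + 1) = e n + g n • S (ζ n) (e (n + 1))`,
where `ζ n` are the data points, `S z` is the score centred at `θs` and `g n` are the learning rates.
Strong concavity makes every step a contraction with factor `(1 + lamf * g n)⁻¹`, which gives
`E‖e n‖² = O(g n)` (`IsImplicitProcess.exists_integral_norm_sq_le`) and with it the consistency of the
averages.

For the variance, let `A` be the Fisher information and `ξ j = S (ζ j) 0` the noise, and write
`A (∑ e (j + 1)) = ∑ ξ j + R n`, the sums being over `j < n`. The noises are independent with covariance
`A`, so it is enough that the variance of `R n` is `o(n)`; then `A Var(∑ e (j + 1)) Aᵀ / n` tends to `A`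
(`tendsto_varianceMatrix_inv`). The mean of `R n` may be of order `√n` if `γ = 1 / 2`, and the noise has
no more than two moments, so that `R n` is estimated only up to a deterministic centring; this is the
notion `IsNegligible`. By `IsImplicitProcess.isNegligible_apply_sum_sub`, `R n` consists of

* a boundary term and a sum of martingale increments bounded by a multiple of `‖e (j + 1)‖` in `L²`;
* `∑ (e (j + 1) - e j) / g j`, which is `O((g n)^(-1/2))` in `L²` after summation by parts;
* `∑ r j (e j)` with `r j x = E[S (ζ j) (e (j + 1)) | e j = x] + A x`.

The last sum is the core of the proof (`IsImplicitProcess.isNegligible_sum`). The functions `r j` are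
Lipschitz, with a Lipschitz constant that is small near the origin because of the integrable bound on the
third derivatives. Let `v k n x` be the expectation of the next `k` terms of the sum, given `e n = x`
(`expectedSum`). The sum equals `v n 0 (e 0)` plus a martingale whose increments are at most
`‖v k (j + 1) (e (j + 1)) - v k (j + 1) (e j)‖` in `L²`. By the contraction, `v k n` has a Lipschitz
constant of order `1 / g n`, and of smaller order near the origin, while a step of the process has size
`O(g j)` times the noise. Since the noise has a fixed law and `e j` tends to zero, the increments tend to
zero in `L²` uniformly in `k` (`IsImplicitProcess.exists_tendsto_bound_increment`), and the variance of
their sum is `o(n)`.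
-/

/-! ### Implicit steps of strongly monotone fields -/

section ImplicitStep

variable {E Z : Type*} [NormedAddCommGroup E] [InnerProductSpace ℝ E] [MeasurableSpace E]
  [MeasurableSpace Z]

/-- A random vector field `S z` on `E`, with `z` of law `Q`: for every `z` it is `L`-Lipschitz and
`-S z` is strongly monotone with constant `lam`, and the value at the origin is a centred square
integrable noise.  The score, as a function of the distance to the true parameter, is of this
kind. -/
structure IsMonotoneField (Q : Measure Z) (S : Z → E → E) (lam L : ℝ) : Prop where
  lam_pos : 0 < lam
  L_nonneg : 0 ≤ L
  measurable : Measurable fun q : Z × E => S q.1 q.2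
  lipschitz : ∀ z a b, ‖S z a - S z b‖ ≤ L * ‖a - b‖
  monotone : ∀ z a b, inner ℝ (S z a - S z b) (a - b) ≤ -lam * ‖a - b‖ ^ 2
  memLp : MemLp (fun z => S z 0) 2 Q
  integral_eq_zero : ∫ z, S z 0 ∂Q = 0

open Classical in
/-- The implicit step from `a`: the solution `x` of `x = a + g • S z x`. -/
noncomputable def implicitStep (S : Z → E → E) (g : ℝ) (z : Z) (a : E) : E :=
  Classical.epsilon fun x => x = a + g • S z x

variable {Q : Measure Z} {S : Z → E → E} {lam L g : ℝ}

omit [MeasurableSpace E] [MeasurableSpace Z] in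
/-- Two solutions of the implicit equation are closer to each other than their starting points. -/
lemma norm_sub_le_of_implicit {s : E → E} (hlam : 0 < lam) (hg : 0 ≤ g)
    (hs : ∀ a b, inner ℝ (s a - s b) (a - b) ≤ -lam * ‖a - b‖ ^ 2) {a b x y : E}
    (hx : x = a + g • s x) (hy : y = b + g • s y) :
    ‖x - y‖ ≤ (1 + lam * g)⁻¹ * ‖a - b‖ := by
  have hab : a - b = (x - y) - g • (s x - s y) := by
    rw [smul_sub]
    nth_rw 1 [hx, hy]
    abel
  have h1 : (1 + lam * g) * ‖x - y‖ ^ 2 ≤ inner ℝ (a - b) (x - y) := by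
    rw [hab, inner_sub_left, inner_smul_left, real_inner_self_eq_norm_sq]
    have := mul_le_mul_of_nonneg_left (hs x y) hg
    simp only [conj_trivial]
    linarith
  have h2 : inner ℝ (a - b) (x - y) ≤ ‖a - b‖ * ‖x - y‖ := real_inner_le_norm _ _
  have hpos : 0 < 1 + lam * g := by positivity
  rw [inv_mul_eq_div, le_div_iff₀ hpos]
  rcases (norm_nonneg (x - y)).eq_or_lt with h0 | h0
  · rw [← h0]; simp
  · nlinarith

/-- The relaxed map `x ↦ x - t (x - g S z x - a)`, whose fixed points solve the implicit
equation. -/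
noncomputable def relaxedStep (S : Z → E → E) (g t : ℝ) (z : Z) (a x : E) : E :=
  x - t • (x - g • S z x - a)

namespace IsMonotoneField

variable (hS : IsMonotoneField Q S lam L)
include hS

/-- With `t = K⁻²`, where `K = 1 + g L` is a Lipschitz constant of `x ↦ x - g S z x`, the relaxed
map is a contraction. -/
lemma exists_contractingWith_relaxedStep (hg : 0 ≤ g) :
    ∃ (t : ℝ) (q : ℝ≥0), t ≠ 0 ∧ ∀ z a, ContractingWith q (relaxedStep S g t z a) := by
  have hL := hS.L_nonneg
  set K : ℝ := 1 + g * L with hK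
  have hK1 : 1 ≤ K := by rw [hK]; nlinarith [mul_nonneg hg hL]
  have hK0 : 0 < K := by linarith
  have hle : (K ^ 2)⁻¹ ≤ 1 := inv_le_one_of_one_le₀ (by nlinarith)
  have hpos : 0 < (K ^ 2)⁻¹ := by positivity
  refine ⟨(K ^ 2)⁻¹, (√(1 - (K ^ 2)⁻¹)).toNNReal, hpos.ne', fun z a => ⟨?_, ?_⟩⟩
  · rw [← NNReal.coe_lt_coe, Real.coe_toNNReal _ (Real.sqrt_nonneg _), NNReal.coe_one,
      Real.sqrt_lt' one_pos]
    linarith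
  · refine LipschitzWith.of_dist_le_mul fun x y => ?_
    rw [Real.coe_toNNReal _ (Real.sqrt_nonneg _)]
    simp only [dist_eq_norm, relaxedStep]
    set u := x - y
    set w := S z x - S z y
    have hdiff : x - (K ^ 2)⁻¹ • (x - g • S z x - a) - (y - (K ^ 2)⁻¹ • (y - g • S z y - a))
        = u - (K ^ 2)⁻¹ • (u - g • w) := by
      simp only [u, w, smul_sub]; abel
    rw [hdiff]
    have hw : ‖u - g • w‖ ≤ K * ‖u‖ := by
      calc ‖u - g • w‖ ≤ ‖u‖ + ‖g • w‖ := norm_sub_le _ _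
        _ ≤ ‖u‖ + g * (L * ‖u‖) := by
          rw [norm_smul, Real.norm_of_nonneg hg]
          gcongr
          exact hS.lipschitz z x y
        _ = K * ‖u‖ := by rw [hK]; ring
    have hin : ‖u‖ ^ 2 ≤ inner ℝ u (u - g • w) := by
      rw [inner_sub_right, inner_smul_right, real_inner_self_eq_norm_sq, real_inner_comm]
      have := mul_le_mul_of_nonneg_left (hS.monotone z x y) hg
      have h3 : 0 ≤ g * (lam * ‖u‖ ^ 2) := by have := hS.lam_pos; positivity
      simp only [u, w] at *
      linarith
    have hsq : ‖u - (K ^ 2)⁻¹ • (u - g • w)‖ ^ 2 ≤ (1 - (K ^ 2)⁻¹) * ‖u‖ ^ 2 := by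
      rw [norm_sub_sq_real, inner_smul_right, norm_smul, Real.norm_of_nonneg hpos.le]
      have h4 : ((K ^ 2)⁻¹ * ‖u - g • w‖) ^ 2 ≤ (K ^ 2)⁻¹ * ‖u‖ ^ 2 := by
        calc ((K ^ 2)⁻¹ * ‖u - g • w‖) ^ 2 ≤ ((K ^ 2)⁻¹ * (K * ‖u‖)) ^ 2 := by gcongr
          _ = (K ^ 2)⁻¹ * ‖u‖ ^ 2 := by field_simp
      have h5 := mul_le_mul_of_nonneg_left hin hpos.le
      linarith
    have h6 : 0 ≤ 1 - (K ^ 2)⁻¹ := by linarith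
    refine abs_le_of_sq_le_sq' ?_ (by positivity) |>.2
    rw [mul_pow, Real.sq_sqrt h6]
    exact hsq

lemma implicitStep_spec [CompleteSpace E] (hg : 0 ≤ g) (z : Z) (a : E) :
    implicitStep S g z a = a + g • S z (implicitStep S g z a) := by
  obtain ⟨t, q, ht, hq⟩ := hS.exists_contractingWith_relaxedStep hg
  refine Classical.epsilon_spec (p := fun x => x = a + g • S z x)
    ⟨(hq z a).fixedPoint, ?_⟩
  have h : relaxedStep S g t z a _ = _ := (hq z a).fixedPoint_isFixedPt
  rw [relaxedStep, sub_eq_self, smul_eq_zero, or_iff_right ht, sub_eq_zero, sub_eq_iff_eq_add] at h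
  exact h

lemma norm_implicitStep_sub_le [CompleteSpace E] (hg : 0 ≤ g) (z : Z) (a b : E) :
    ‖implicitStep S g z a - implicitStep S g z b‖ ≤ (1 + lam * g)⁻¹ * ‖a - b‖ :=
  norm_sub_le_of_implicit hS.lam_pos hg (hS.monotone z) (hS.implicitStep_spec hg z a)
    (hS.implicitStep_spec hg z b)

lemma eq_implicitStep [CompleteSpace E] (hg : 0 ≤ g) {z : Z} {a x : E}
    (hx : x = a + g • S z x) : x = implicitStep S g z a := by
  have h := norm_sub_le_of_implicit hS.lam_pos hg (hS.monotone z) hx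
    (hS.implicitStep_spec hg z a)
  rw [sub_self, norm_zero, mul_zero] at h
  exact sub_eq_zero.1 (norm_le_zero_iff.1 h)

lemma inv_one_add_le_one (hg : 0 ≤ g) : (1 + lam * g)⁻¹ ≤ 1 :=
  inv_le_one_of_one_le₀ (by nlinarith [mul_nonneg hS.lam_pos.le hg])

lemma norm_implicitStep_sub_le' [CompleteSpace E] (hg : 0 ≤ g) (z : Z) (a b : E) :
    ‖implicitStep S g z a - implicitStep S g z b‖ ≤ ‖a - b‖ :=
  (hS.norm_implicitStep_sub_le hg z a b).trans
    (mul_le_of_le_one_left (norm_nonneg _) (hS.inv_one_add_le_one hg))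

/-- The step from `-g • S z 0` ends at the origin; the claim is the contraction property for this
starting point. -/
lemma norm_implicitStep_le [CompleteSpace E] (hg : 0 ≤ g) (z : Z) (a : E) :
    ‖implicitStep S g z a‖ ≤ (1 + lam * g)⁻¹ * ‖a + g • S z 0‖ := by
  have h0 : (0 : E) = -(g • S z 0) + g • S z 0 := by simp
  have h := norm_sub_le_of_implicit hS.lam_pos hg (hS.monotone z)
    (hS.implicitStep_spec hg z a) h0
  simpa using h

lemma norm_implicitStep_le' [CompleteSpace E] (hg : 0 ≤ g) (z : Z) (a : E) :
    ‖implicitStep S g z a‖ ≤ ‖a‖ + g * ‖S z 0‖ := by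
  refine (hS.norm_implicitStep_le hg z a).trans
    ((mul_le_of_le_one_left (norm_nonneg _) (hS.inv_one_add_le_one hg)).trans ?_)
  refine (norm_add_le _ _).trans ?_
  rw [norm_smul, Real.norm_of_nonneg hg]

lemma norm_apply_le (z : Z) (a : E) : ‖S z a‖ ≤ ‖S z 0‖ + L * ‖a‖ := by
  have h := hS.lipschitz z a 0
  rw [sub_zero] at h
  calc ‖S z a‖ = ‖S z 0 + (S z a - S z 0)‖ := by congr 1; abel
    _ ≤ ‖S z 0‖ + L * ‖a‖ := (norm_add_le _ _).trans (by gcongr)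

lemma measurable_implicitStep [CompleteSpace E] [BorelSpace E] [SecondCountableTopology E]
    (hg : 0 ≤ g) : Measurable fun q : E × Z => implicitStep S g q.2 q.1 := by
  obtain ⟨t, q, ht, hq⟩ := hS.exists_contractingWith_relaxedStep hg
  have hit : ∀ n : ℕ, Measurable fun w : E × Z => (relaxedStep S g t w.2 w.1)^[n] 0 := by
    intro n
    induction n with
    | zero => exact measurable_const
    | succ n ih =>
      simp only [Function.iterate_succ_apply', relaxedStep]
      have h1 := hS.measurable.comp (measurable_snd.prodMk ih)
      simp only [Function.comp_def] at h1
      exact ih.sub (((ih.sub (h1.const_smul g)).sub measurable_fst).const_smul t)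
  refine measurable_of_tendsto_metrizable hit (tendsto_pi_nhds.2 fun w => ?_)
  have h : implicitStep S g w.2 w.1 = (hq w.2 w.1).fixedPoint := by
    refine (hq w.2 w.1).fixedPoint_unique ?_
    rw [Function.IsFixedPt, relaxedStep, sub_eq_self]
    have h3 := hS.implicitStep_spec hg w.2 w.1
    rw [smul_eq_zero, sub_sub, sub_eq_zero]
    right
    nth_rw 1 [h3]
    abel
  rw [h]
  exact (hq w.2 w.1).tendsto_iterate_fixedPoint 0

end IsMonotoneField

end ImplicitStep

/-! ### Second moments of martingale increments -/

section MartingaleIncrement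

lemma lintegral_ofReal_norm_sq_lt_top {α E : Type*} [MeasurableSpace α]
    [NormedAddCommGroup E] {μ : Measure α}
    {X : α → E}
    (hX : MemLp X 2 μ) : ∫⁻ ω, ENNReal.ofReal (‖X ω‖ ^ 2) ∂μ < ⊤ :=
  (hasFiniteIntegral_iff_ofReal (ae_of_all _ fun _ => sq_nonneg _)).1
    (hX.integrable_norm_pow two_ne_zero).hasFiniteIntegral

variable {E Z Ω : Type*} [NormedAddCommGroup E] [InnerProductSpace ℝ E] [CompleteSpace E]
  [MeasurableSpace Z] {Q : Measure Z}

/-- The bias-variance identity: centring a random vector at its mean minimises the second moment,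
and a centred random vector is orthogonal to constants. -/
lemma integral_norm_add_sub_integral_sq_le [IsProbabilityMeasure Q] {h : Z → E}
    (hh : MemLp h 2 Q) (T c : E) :
    ∫ z, ‖T + (h z - ∫ y, h y ∂Q)‖ ^ 2 ∂Q ≤ ‖T‖ ^ 2 + ∫ z, ‖h z - c‖ ^ 2 ∂Q := by
  set m := ∫ y, h y ∂Q with hm
  have hint : Integrable h Q := hh.integrable one_le_two
  have hcent : ∀ w : E, ∫ z, inner ℝ w (h z - m) ∂Q = 0 := by
    intro w
    have h1 : ∫ z, (h z - m) ∂Q = 0 := by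
      rw [integral_sub hint (integrable_const m)]
      simp [hm]
    have h2 : Integrable (fun z => h z - m) Q := hint.sub (integrable_const m)
    rw [integral_inner h2, h1, inner_zero_right]
  have hi : ∀ w : E, Integrable (fun z => inner ℝ w (h z - m)) Q := fun w =>
    (hint.sub (integrable_const m)).const_inner w
  have hc : Integrable (fun z => ‖h z - c‖ ^ 2) Q :=
    (hh.sub (memLp_const c)).integrable_norm_pow two_ne_zero
  have key : ∀ z, ‖T + (h z - m)‖ ^ 2
      ≤ ‖T‖ ^ 2 + ‖h z - c‖ ^ 2 + 2 * inner ℝ (T - (m - c)) (h z - m) := by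
    intro z
    have h1 : h z - c = (m - c) + (h z - m) := by abel
    rw [h1, norm_add_sq_real, norm_add_sq_real, inner_sub_left T (m - c)]
    linarith [sq_nonneg ‖m - c‖]
  have i1 : Integrable (fun z => ‖T‖ ^ 2 + ‖h z - c‖ ^ 2) Q := (integrable_const _).add hc
  have i2 : Integrable (fun z => 2 * inner ℝ (T - (m - c)) (h z - m)) Q := (hi _).const_mul 2
  have i3 : Integrable (fun z => ‖T + (h z - m)‖ ^ 2) Q :=
    ((memLp_const T).add (hh.sub (memLp_const m))).integrable_norm_pow two_ne_zero
  refine (integral_mono i3 (i1.add i2) key).trans_eq ?_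
  rw [integral_add' i1 i2, integral_const_mul, hcent, integral_add (integrable_const _) hc]
  simp

lemma lintegral_norm_add_sub_integral_sq_le [IsProbabilityMeasure Q] {h : Z → E}
    (hh : MemLp h 2 Q) (T c : E) :
    ∫⁻ z, ENNReal.ofReal (‖T + (h z - ∫ y, h y ∂Q)‖ ^ 2) ∂Q
      ≤ ENNReal.ofReal (‖T‖ ^ 2) + ∫⁻ z, ENNReal.ofReal (‖h z - c‖ ^ 2) ∂Q := by
  have i1 : Integrable (fun z => ‖h z - c‖ ^ 2) Q :=
    (hh.sub (memLp_const c)).integrable_norm_pow two_ne_zero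
  have i2 : Integrable (fun z => ‖T + (h z - ∫ y, h y ∂Q)‖ ^ 2) Q :=
    ((memLp_const T).add (hh.sub (memLp_const _))).integrable_norm_pow two_ne_zero
  rw [← ofReal_integral_eq_lintegral_ofReal i1 (ae_of_all _ fun _ => sq_nonneg _),
    ← ofReal_integral_eq_lintegral_ofReal i2 (ae_of_all _ fun _ => sq_nonneg _),
    ← ENNReal.ofReal_add (sq_nonneg _) (integral_nonneg fun _ => sq_nonneg _)]
  exact ENNReal.ofReal_le_ofReal (integral_norm_add_sub_integral_sq_le hh T c)

variable {m m0 : MeasurableSpace Ω} {P : Measure Ω} [MeasurableSpace E]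
  [BorelSpace E] [SecondCountableTopology E]

/-- Adding a martingale increment `G(x, ζ) - ∫ G(x, ·) dQ`, where `ζ` is independent of the past
`m`, to a random vector `T` of the past adds to the second moment at most the second moment of
`G(x, ζ) - c(x)`, whatever the centring `c`. -/
lemma memLp_add_increment_and_integral_le [IsProbabilityMeasure P] (hm : m ≤ m0)
    {ζ : Ω → Z} (hζ : Measurable ζ) (hindep : Indep m (MeasurableSpace.comap ζ inferInstance) P)
    (hlaw : P.map ζ = Q) {T x : Ω → E} (hT : Measurable[m] T) (hx : Measurable[m] x)
    (hT2 : MemLp T 2 P) {G : E → Z → E} (hG : Measurable fun q : E × Z => G q.1 q.2)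
    (hG2 : ∀ a, MemLp (G a) 2 Q) {c : E → E} (hc : Measurable c)
    (hGc : MemLp (fun ω => G (x ω) (ζ ω) - c (x ω)) 2 P) :
    MemLp (fun ω => T ω + (G (x ω) (ζ ω) - ∫ z, G (x ω) z ∂Q)) 2 P ∧
      ∫ ω, ‖T ω + (G (x ω) (ζ ω) - ∫ z, G (x ω) z ∂Q)‖ ^ 2 ∂P
        ≤ ∫ ω, ‖T ω‖ ^ 2 ∂P + ∫ ω, ‖G (x ω) (ζ ω) - c (x ω)‖ ^ 2 ∂P := by
  have hQ : IsProbabilityMeasure Q := hlaw ▸ Measure.isProbabilityMeasure_map hζ.aemeasurable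
  have hT0 : Measurable T := hT.mono hm le_rfl
  have hx0 : Measurable x := hx.mono hm le_rfl
  have hU : Measurable fun ω => (T ω, x ω) := hT0.prodMk hx0
  have hI : IndepFun (fun ω => (T ω, x ω)) ζ P := by
    rw [IndepFun_iff_Indep]
    exact indep_of_indep_of_le_left hindep (hT.prodMk hx).comap_le
  have hmap : P.map (fun ω => ((T ω, x ω), ζ ω)) = (P.map fun ω => (T ω, x ω)).prod Q := by
    rw [(indepFun_iff_map_prod_eq_prod_map_map hU.aemeasurable hζ.aemeasurable).1 hI, hlaw]
  have hprob : IsProbabilityMeasure (P.map fun ω => (T ω, x ω)) :=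
    Measure.isProbabilityMeasure_map hU.aemeasurable
  have hbar : Measurable fun a => ∫ z, G a z ∂Q :=
    (hG.stronglyMeasurable.integral_prod_right (ν := Q)).measurable
  have hfst : Measurable fun u : (E × E) × Z => u.1.2 := measurable_fst.snd
  have hGm : Measurable fun u : (E × E) × Z => G u.1.2 u.2 :=
    hG.comp (hfst.prodMk measurable_snd)
  have hφ : Measurable fun u : (E × E) × Z => u.1.1 + (G u.1.2 u.2 - ∫ z, G u.1.2 z ∂Q) :=
    measurable_fst.fst.add (hGm.sub (hbar.comp hfst))
  have hψ : Measurable fun u : (E × E) × Z => G u.1.2 u.2 - c u.1.2 := hGm.sub (hc.comp hfst)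
  have hfub : ∀ Φ : (E × E) × Z → E, Measurable Φ →
      ∫⁻ ω, ENNReal.ofReal (‖Φ ((T ω, x ω), ζ ω)‖ ^ 2) ∂P
        = ∫⁻ ω, ∫⁻ z, ENNReal.ofReal (‖Φ ((T ω, x ω), z)‖ ^ 2) ∂Q ∂P := by
    intro Φ hΦ
    have h1 : Measurable fun u => ENNReal.ofReal (‖Φ u‖ ^ 2) :=
      ENNReal.measurable_ofReal.comp (hΦ.norm.pow_const 2)
    rw [← lintegral_map (f := fun u => ENNReal.ofReal (‖Φ u‖ ^ 2)) h1 (hU.prodMk hζ), hmap,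
      lintegral_prod _ h1.aemeasurable, lintegral_map h1.lintegral_prod_right' hU]
  have hle : ∫⁻ ω, ENNReal.ofReal (‖T ω + (G (x ω) (ζ ω) - ∫ z, G (x ω) z ∂Q)‖ ^ 2) ∂P
      ≤ ∫⁻ ω, ENNReal.ofReal (‖T ω‖ ^ 2) ∂P
        + ∫⁻ ω, ENNReal.ofReal (‖G (x ω) (ζ ω) - c (x ω)‖ ^ 2) ∂P := by
    have hTm : Measurable fun ω => ENNReal.ofReal (‖T ω‖ ^ 2) :=
      ENNReal.measurable_ofReal.comp (hT0.norm.pow_const 2)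
    rw [hfub _ hφ, hfub _ hψ, ← lintegral_add_left hTm]
    refine lintegral_mono fun ω => ?_
    exact lintegral_norm_add_sub_integral_sq_le (hG2 (x ω)) (T ω) (c (x ω))
  have hmem : MemLp (fun ω => T ω + (G (x ω) (ζ ω) - ∫ z, G (x ω) z ∂Q)) 2 P := by
    have hmeas := (hφ.comp (hU.prodMk hζ)).aestronglyMeasurable (μ := P)
    refine (memLp_two_iff_integrable_sq_norm hmeas).2 ⟨(hmeas.norm.pow 2), ?_⟩
    exact (hasFiniteIntegral_iff_ofReal (ae_of_all _ fun _ => sq_nonneg _)).2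
      (hle.trans_lt (ENNReal.add_lt_top.2 ⟨lintegral_ofReal_norm_sq_lt_top hT2,
        lintegral_ofReal_norm_sq_lt_top hGc⟩))
  refine ⟨hmem, ?_⟩
  rw [← ofReal_integral_eq_lintegral_ofReal (hmem.integrable_norm_pow two_ne_zero)
      (ae_of_all _ fun _ => sq_nonneg _),
    ← ofReal_integral_eq_lintegral_ofReal (hT2.integrable_norm_pow two_ne_zero)
      (ae_of_all _ fun _ => sq_nonneg _),
    ← ofReal_integral_eq_lintegral_ofReal (hGc.integrable_norm_pow two_ne_zero)
      (ae_of_all _ fun _ => sq_nonneg _),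
    ← ENNReal.ofReal_add (integral_nonneg fun _ => sq_nonneg _)
      (integral_nonneg fun _ => sq_nonneg _)] at hle
  exact (ENNReal.ofReal_le_ofReal_iff (add_nonneg (integral_nonneg fun _ => sq_nonneg _)
      (integral_nonneg fun _ => sq_nonneg _))).1 hle

end MartingaleIncrement

/-! ### Step sizes -/

section StepSizes

/-- Learning rates `g n` together with a comparable sequence `t n` that decreases so slowly that the
contraction factors `(1 + lam * g n)⁻¹` dominate its decay.  The sequence `t` serves as a
supersolution of recursive inequalities, forwards in time for `t` and backwards for `1 / t`. -/
structure IsStepSize (g t : ℕ → ℝ) (lam C : ℝ) : Prop where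
  pos : ∀ n, 0 < g n
  antitone : Antitone g
  tendsto : Tendsto g atTop (𝓝 0)
  tendsto_mul : Tendsto (fun n : ℕ => (n : ℝ)⁻¹ * (g n)⁻¹) atTop (𝓝 0)
  t_pos : ∀ n, 0 < t n
  C_pos : 0 < C
  t_le : ∀ n, t n ≤ C * g n
  g_le : ∀ n, g n ≤ C * t (n + 1)
  t_sub_le : ∀ n, t n - t (n + 1) ≤ lam / 2 * g n * t (n + 1)

/-- The polynomial rates `γ₁ (n + 1) ^ (-γ)` are compared with the shifted ones `(n + k) ^ (-γ)`,
whose relative decay `≤ k ^ (γ - 1) (n + k) ^ (-γ)` is as slow as needed for large `k`. -/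
lemma exists_isStepSize {γ₁ γ lam : ℝ} (hγ₁ : 0 < γ₁) (hγ0 : 0 < γ) (hγ1 : γ < 1)
    (hlam : 0 < lam) :
    ∃ t C, IsStepSize (fun n : ℕ => γ₁ * ((n + 1 : ℕ) : ℝ) ^ (-γ)) t lam C := by
  obtain ⟨k, hk1, hk⟩ : ∃ k : ℕ, 1 ≤ k ∧ (k : ℝ) ^ (γ - 1) ≤ lam * γ₁ / 2 := by
    have h : Tendsto (fun k : ℕ => (k : ℝ) ^ (-(1 - γ))) atTop (𝓝 0) :=
      (tendsto_rpow_neg_atTop (by linarith)).comp tendsto_natCast_atTop_atTop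
    have h2 := (h.eventually_le_const (show 0 < lam * γ₁ / 2 by positivity)).and
      (eventually_ge_atTop 1)
    obtain ⟨k, hk, hk1⟩ := h2.exists
    exact ⟨k, hk1, by simpa using hk⟩
  have hk0 : (1 : ℝ) ≤ k := by exact_mod_cast hk1
  have hC1 : 0 ≤ γ₁⁻¹ := by positivity
  have hC2 : 0 ≤ γ₁ * (1 + k) := by positivity
  refine ⟨fun n => ((n : ℝ) + k) ^ (-γ), γ₁⁻¹ + γ₁ * (1 + k), ?_, ?_, ?_, ?_, ?_, ?_, ?_, ?_, ?_⟩
  · intro n; positivity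
  · intro a b hab
    have : ((a + 1 : ℕ) : ℝ) ≤ ((b + 1 : ℕ) : ℝ) := by exact_mod_cast Nat.succ_le_succ hab
    exact mul_le_mul_of_nonneg_left
      (Real.rpow_le_rpow_of_nonpos (by positivity) this (by linarith)) hγ₁.le
  · have h : Tendsto (fun n : ℕ => ((n + 1 : ℕ) : ℝ) ^ (-γ)) atTop (𝓝 0) :=
      (tendsto_rpow_neg_atTop hγ0).comp
        (tendsto_natCast_atTop_atTop.comp (tendsto_add_atTop_nat 1))
    simpa using h.const_mul γ₁
  · have h : Tendsto (fun n : ℕ => γ₁⁻¹ * 2 * (n : ℝ) ^ (-(1 - γ))) atTop (𝓝 0) := by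
      have := ((tendsto_rpow_neg_atTop (show 0 < 1 - γ by linarith)).comp
        tendsto_natCast_atTop_atTop).const_mul (γ₁⁻¹ * 2)
      simpa using this
    refine squeeze_zero' (Eventually.of_forall fun n => by positivity) ?_ h
    filter_upwards [eventually_ge_atTop 1] with n hn
    have hn1 : (1 : ℝ) ≤ n := by exact_mod_cast hn
    have hn0 : (0 : ℝ) < n := by linarith
    have h1 : ((n + 1 : ℕ) : ℝ) ^ γ ≤ 2 * (n : ℝ) ^ γ := by
      calc ((n + 1 : ℕ) : ℝ) ^ γ ≤ (2 * n : ℝ) ^ γ := by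
            refine Real.rpow_le_rpow (by positivity) ?_ hγ0.le
            push_cast; linarith
        _ = 2 ^ γ * (n : ℝ) ^ γ := Real.mul_rpow (by norm_num) hn0.le
        _ ≤ 2 ^ (1 : ℝ) * (n : ℝ) ^ γ := by
            gcongr
            norm_num
        _ = 2 * (n : ℝ) ^ γ := by rw [Real.rpow_one]
    rw [mul_inv, Real.rpow_neg (by positivity), inv_inv, neg_sub, Real.rpow_sub_one hn0.ne']
    calc (n : ℝ)⁻¹ * (γ₁⁻¹ * ((n + 1 : ℕ) : ℝ) ^ γ) ≤ (n : ℝ)⁻¹ * (γ₁⁻¹ * (2 * (n : ℝ) ^ γ)) := by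
          gcongr
      _ = _ := by field_simp
  · intro n; positivity
  · positivity
  · intro n
    have h1 : ((n : ℝ) + k) ^ (-γ) ≤ ((n + 1 : ℕ) : ℝ) ^ (-γ) := by
      refine Real.rpow_le_rpow_of_nonpos (by positivity) ?_ (by linarith)
      push_cast; linarith
    have h0 : 0 ≤ ((n + 1 : ℕ) : ℝ) ^ (-γ) := by positivity
    calc ((n : ℝ) + k) ^ (-γ) ≤ γ₁⁻¹ * (γ₁ * ((n + 1 : ℕ) : ℝ) ^ (-γ)) := by
          rwa [inv_mul_cancel_left₀ hγ₁.ne']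
      _ ≤ _ := by
          refine mul_le_mul_of_nonneg_right ?_ (by positivity)
          linarith
  · intro n
    have hn : (0 : ℝ) < ((n + 1 : ℕ) : ℝ) := by positivity
    have h1 : (((n + 1 : ℕ) : ℝ) + k) ^ γ ≤ (1 + k) * ((n + 1 : ℕ) : ℝ) ^ γ := by
      calc (((n + 1 : ℕ) : ℝ) + k) ^ γ ≤ ((1 + k) * ((n + 1 : ℕ) : ℝ)) ^ γ := by
            refine Real.rpow_le_rpow (by positivity) ?_ hγ0.le
            push_cast; nlinarith [(Nat.cast_nonneg n : (0 : ℝ) ≤ n)]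
        _ = (1 + k) ^ γ * ((n + 1 : ℕ) : ℝ) ^ γ := Real.mul_rpow (by positivity) hn.le
        _ ≤ (1 + k : ℝ) ^ (1 : ℝ) * ((n + 1 : ℕ) : ℝ) ^ γ := by
            gcongr
            linarith
        _ = _ := by rw [Real.rpow_one]
    have h2 : ((n + 1 : ℕ) : ℝ) ^ (-γ) ≤ (1 + k) * (((n + 1 : ℕ) : ℝ) + k) ^ (-γ) := by
      rw [Real.rpow_neg hn.le, Real.rpow_neg (by positivity), ← div_eq_mul_inv,
        le_div_iff₀ (by positivity), inv_mul_le_iff₀ (by positivity), mul_comm]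
      exact h1
    calc γ₁ * ((n + 1 : ℕ) : ℝ) ^ (-γ) ≤ γ₁ * ((1 + k) * (((n + 1 : ℕ) : ℝ) + k) ^ (-γ)) := by
          gcongr
      _ = γ₁ * (1 + k) * (((n + 1 : ℕ) : ℝ) + k) ^ (-γ) := by ring
      _ ≤ _ := by
          refine mul_le_mul_of_nonneg_right ?_ (by positivity)
          linarith
  · intro n
    have hx : 0 < (n : ℝ) + k := by positivity
    have hx1 : ((n + 1 : ℕ) : ℝ) + k = ((n : ℝ) + k) + 1 := by push_cast; ring
    rw [hx1]
    set x := (n : ℝ) + k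
    have hkx : (k : ℝ) ≤ x := by simp [x]
    have h1 : (x + 1) ^ γ ≤ x ^ γ + x ^ (γ - 1) := by
      have h3 : x + 1 = x * (1 + x⁻¹) := by field_simp
      have h4 : (1 + x⁻¹) ^ γ ≤ 1 + x⁻¹ := by
        calc (1 + x⁻¹) ^ γ ≤ (1 + x⁻¹) ^ (1 : ℝ) :=
              Real.rpow_le_rpow_of_exponent_le (by simp [hx.le]) hγ1.le
          _ = 1 + x⁻¹ := Real.rpow_one _
      rw [h3, Real.mul_rpow hx.le (by positivity), Real.rpow_sub_one hx.ne']
      calc x ^ γ * (1 + x⁻¹) ^ γ ≤ x ^ γ * (1 + x⁻¹) := by gcongr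
        _ = _ := by field_simp
    have h2 : x ^ (γ - 1) ≤ lam * γ₁ / 2 :=
      (Real.rpow_le_rpow_of_nonpos (by positivity) hkx (by linarith)).trans hk
    have h5 : x ^ (-γ) - (x + 1) ^ (-γ) = x ^ (-γ) * (x + 1) ^ (-γ) * ((x + 1) ^ γ - x ^ γ) := by
      rw [Real.rpow_neg hx.le, Real.rpow_neg (by positivity)]
      have h6 : x ^ γ ≠ 0 := by positivity
      have h7 : (x + 1) ^ γ ≠ 0 := by positivity
      field_simp
    have h8 : x ^ (-γ) ≤ ((n + 1 : ℕ) : ℝ) ^ (-γ) := by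
      refine Real.rpow_le_rpow_of_nonpos (by positivity) ?_ (by linarith)
      simp only [x]; push_cast; linarith
    have h9 : 0 ≤ (x + 1) ^ γ - x ^ γ :=
      sub_nonneg.2 (Real.rpow_le_rpow hx.le (by linarith) hγ0.le)
    rw [h5]
    calc x ^ (-γ) * (x + 1) ^ (-γ) * ((x + 1) ^ γ - x ^ γ)
        ≤ ((n + 1 : ℕ) : ℝ) ^ (-γ) * (x + 1) ^ (-γ) * (lam * γ₁ / 2) := by
          gcongr
          linarith
      _ = _ := by ring

namespace IsStepSize

variable {g t : ℕ → ℝ} {lam C : ℝ} (hg : IsStepSize g t lam C)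
include hg

/-- A second moment that contracts at rate `(1 + lam * g n)⁻¹` and picks up noise of size `g n ^ 2`
is of the order of `g n`. -/
lemma exists_le_mul_of_recursion (hlam : 0 < lam) {s : ℕ → ℝ} {v : ℝ} (hv : 0 ≤ v) (hs0 : 0 ≤ s 0)
    (hs : ∀ n, s (n + 1) ≤ (1 + lam * g n)⁻¹ * (s n + g n ^ 2 * v)) :
    ∃ D, 0 ≤ D ∧ ∀ n, s n ≤ D * g n := by
  have hC := hg.C_pos
  have ht0 := hg.t_pos 0
  set D := s 0 / t 0 + 2 * C * v / lam with hD
  have h2 : 0 ≤ 2 * C * v / lam := by positivity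
  have h1 : 0 ≤ s 0 / t 0 := by positivity
  have hD0 : 0 ≤ D := by positivity
  have key : ∀ n, s n ≤ D * t n := by
    intro n
    induction n with
    | zero =>
      calc s 0 = s 0 / t 0 * t 0 := by field_simp
        _ ≤ D * t 0 := by gcongr; linarith
    | succ n ih =>
      have hgn := hg.pos n
      have htn := hg.t_pos (n + 1)
      have hpos : 0 < 1 + lam * g n := by positivity
      refine (hs n).trans ?_
      rw [inv_mul_le_iff₀ hpos]
      have e1 : D * (t n - t (n + 1)) ≤ D * (lam / 2 * g n * t (n + 1)) :=
        mul_le_mul_of_nonneg_left (hg.t_sub_le n) hD0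
      have e2 : g n ^ 2 * v ≤ D * (lam / 2 * g n * t (n + 1)) := by
        have e3 : g n * v ≤ D * (lam / 2 * t (n + 1)) := by
          calc g n * v ≤ C * t (n + 1) * v := by gcongr; exact hg.g_le n
            _ = 2 * C * v / lam * (lam / 2 * t (n + 1)) := by field_simp
            _ ≤ _ := by gcongr; linarith
        calc g n ^ 2 * v = g n * (g n * v) := by ring
          _ ≤ g n * (D * (lam / 2 * t (n + 1))) := by gcongr
          _ = _ := by ring
      linarith
  refine ⟨D * C, by positivity, fun n => (key n).trans ?_⟩
  rw [mul_assoc]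
  exact mul_le_mul_of_nonneg_left (hg.t_le n) hD0

/-- A bound, of the order of `1 / g n`, for the sums of products of contraction factors
`∑ j ≥ n, ∏ i ∈ [n, j), (1 + lam * g i)⁻¹`. -/
lemma exists_potential (hlam : 0 < lam) :
    ∃ (a : ℕ → ℝ) (K : ℝ), 0 < K ∧ (∀ n, 0 < a n) ∧
      (∀ n, 1 + (1 + lam * g n)⁻¹ * a (n + 1) ≤ a n) ∧ ∀ n, g n * a (n + 1) ≤ K := by
  have hC := hg.C_pos
  have hg0 := hg.pos 0
  set c := 2 * C * (1 + lam * g 0) / lam with hc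
  have hc0 : 0 < c := by positivity
  refine ⟨fun n => c / t n, c * C, by positivity, fun n => div_pos hc0 (hg.t_pos n), fun n => ?_,
    fun n => ?_⟩
  · have hgn := hg.pos n
    have htn := hg.t_pos n
    have htn1 := hg.t_pos (n + 1)
    have hpos : 0 < 1 + lam * g n := by positivity
    have e1 : c / t (n + 1) - c / t n ≤ lam / 2 * g n * (c / t n) := by
      have : c / t (n + 1) - c / t n = c / (t n * t (n + 1)) * (t n - t (n + 1)) := by
        field_simp
      rw [this]
      calc c / (t n * t (n + 1)) * (t n - t (n + 1))
          ≤ c / (t n * t (n + 1)) * (lam / 2 * g n * t (n + 1)) := by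
            gcongr; exact hg.t_sub_le n
        _ = _ := by field_simp
    have e2 : 1 + lam * g n ≤ lam / 2 * g n * (c / t n) := by
      calc 1 + lam * g n ≤ 1 + lam * g 0 := by gcongr; exact hg.antitone (Nat.zero_le n)
        _ = lam / 2 * (c / C) := by rw [hc]; field_simp
        _ ≤ lam / 2 * (c * (g n / t n)) := by
            rw [div_eq_mul_inv c C]
            gcongr
            rw [le_div_iff₀ htn, inv_mul_le_iff₀ hC]
            exact hg.t_le n
        _ = _ := by ring
    have e3 : (1 + (1 + lam * g n)⁻¹ * (c / t (n + 1))) * (1 + lam * g n)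
        ≤ c / t n * (1 + lam * g n) := by
      have : (1 + (1 + lam * g n)⁻¹ * (c / t (n + 1))) * (1 + lam * g n)
          = 1 + lam * g n + c / t (n + 1) := by field_simp
      rw [this]
      linarith
    exact le_of_mul_le_mul_right e3 hpos
  · have htn1 := hg.t_pos (n + 1)
    rw [mul_div_assoc', div_le_iff₀ htn1, mul_comm (g n), mul_assoc]
    exact mul_le_mul_of_nonneg_left (hg.g_le n) hc0.le

end IsStepSize

end StepSizes

/-! ### The implicit process and its second moments -/

section StochasticApproximation

variable {E Z Ω : Type*} [NormedAddCommGroup E] [InnerProductSpace ℝ E] [CompleteSpace E]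
  [MeasurableSpace E] [BorelSpace E] [SecondCountableTopology E] [MeasurableSpace Z]
  {Q : Measure Z} {S : Z → E → E} {lam L : ℝ}

omit [InnerProductSpace ℝ E] [CompleteSpace E] [MeasurableSpace E] [BorelSpace E]
  [SecondCountableTopology E] in
lemma memLp_comp_of_norm_sub_le {α : Type*} [MeasurableSpace α] {μ : Measure α} [IsFiniteMeasure μ]
    {f : α → E} (hf : MemLp f 2 μ) {v : E → E} {K : ℝ}
    (hv : ∀ a b, ‖v a - v b‖ ≤ K * ‖a - b‖) : MemLp (fun x => v (f x)) 2 μ := by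
  have hcont : Continuous v := by
    refine (LipschitzWith.of_dist_le_mul (K := K.toNNReal) fun a b => ?_).continuous
    rw [dist_eq_norm, dist_eq_norm]
    refine (hv a b).trans ?_
    gcongr
    exact Real.le_coe_toNNReal K
  have hdom : MemLp (fun x => ‖v 0‖ + K * ‖f x‖) 2 μ := (memLp_const ‖v 0‖).add (hf.norm.const_mul K)
  refine hdom.mono' (hcont.comp_aestronglyMeasurable hf.1) (ae_of_all _ fun x => ?_)
  have h := hv (f x) 0
  rw [sub_zero] at h
  calc ‖v (f x)‖ = ‖v 0 + (v (f x) - v 0)‖ := by congr 1; abel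
    _ ≤ ‖v 0‖ + K * ‖f x‖ := (norm_add_le _ _).trans (by gcongr)

omit [SecondCountableTopology E] [CompleteSpace E] [InnerProductSpace ℝ E] in
lemma measurable_of_norm_sub_le {v : E → E} {K : ℝ}
    (hv : ∀ a b, ‖v a - v b‖ ≤ K * ‖a - b‖) : Measurable v := by
  refine (LipschitzWith.of_dist_le_mul (K := K.toNNReal) fun a b => ?_).continuous.measurable
  rw [dist_eq_norm, dist_eq_norm]
  refine (hv a b).trans ?_
  gcongr
  exact Real.le_coe_toNNReal K

namespace IsMonotoneField

variable (hS : IsMonotoneField Q S lam L)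
include hS

lemma memLp_implicitStep [IsProbabilityMeasure Q] {g : ℝ} (hg : 0 ≤ g) (a : E) :
    MemLp (fun z => implicitStep S g z a) 2 Q := by
  have hdom : MemLp (fun z => ‖a‖ + g * ‖S z 0‖) 2 Q :=
    (memLp_const ‖a‖).add (hS.memLp.norm.const_mul g)
  exact hdom.mono' ((hS.measurable_implicitStep hg).comp
    (measurable_const.prodMk measurable_id)).aestronglyMeasurable
    (ae_of_all _ fun z => hS.norm_implicitStep_le' hg z a)

lemma integral_norm_implicitStep_sq_le [IsProbabilityMeasure Q] {g : ℝ} (hg : 0 ≤ g) (a : E) :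
    ∫ z, ‖implicitStep S g z a‖ ^ 2 ∂Q ≤ ‖a‖ ^ 2 + g ^ 2 * ∫ z, ‖S z 0‖ ^ 2 ∂Q := by
  have hm : MemLp (fun z => g • S z 0) 2 Q := hS.memLp.const_smul g
  have h0 : ∫ z, g • S z 0 ∂Q = 0 := by
    rw [integral_smul, hS.integral_eq_zero, smul_zero]
  have h := integral_norm_add_sub_integral_sq_le hm a 0
  simp only [h0, sub_zero, norm_smul, mul_pow, Real.norm_eq_abs, sq_abs] at h
  rw [integral_const_mul] at h
  refine le_trans (integral_mono ((hS.memLp_implicitStep hg a).integrable_norm_pow two_ne_zero)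
    (((memLp_const a).add hm).integrable_norm_pow two_ne_zero) fun z => ?_) h
  have h1 : ‖implicitStep S g z a‖ ≤ ‖a + g • S z 0‖ :=
    (hS.norm_implicitStep_le hg z a).trans
      (mul_le_of_le_one_left (norm_nonneg _) (hS.inv_one_add_le_one hg))
  simp only
  gcongr
  exact h1

end IsMonotoneField

/-- The implicit stochastic approximation `e (n + 1) = e n + g n • S (ζ n) (e (n + 1))`, adapted to
a filtration `ℱ` such that the data point `ζ n`, of law `Q`, is independent of `ℱ n`. -/
structure IsImplicitProcess {m0 : MeasurableSpace Ω} (P : Measure Ω) (Q : Measure Z)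
    (S : Z → E → E) (g : ℕ → ℝ) (ℱ : Filtration ℕ m0) (ζ : ℕ → Ω → Z) (e : ℕ → Ω → E) :
    Prop where
  measurable_data : ∀ n, Measurable[ℱ (n + 1)] (ζ n)
  law : ∀ n, P.map (ζ n) = Q
  indep : ∀ n, Indep (ℱ n) (MeasurableSpace.comap (ζ n) inferInstance) P
  measurable_zero : Measurable[ℱ 0] (e 0)
  memLp_zero : MemLp (e 0) 2 P
  step : ∀ n ω, e (n + 1) ω = implicitStep S (g n) (ζ n ω) (e n ω)

namespace IsImplicitProcess

variable {m0 : MeasurableSpace Ω} {P : Measure Ω} [IsProbabilityMeasure P] {g : ℕ → ℝ}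
  {ℱ : Filtration ℕ m0} {ζ : ℕ → Ω → Z} {e : ℕ → Ω → E}
  (he : IsImplicitProcess P Q S g ℱ ζ e) (hS : IsMonotoneField Q S lam L)

include he in
omit [CompleteSpace E] [BorelSpace E] [SecondCountableTopology E] [IsProbabilityMeasure P] in
lemma measurable_data' (n : ℕ) : Measurable (ζ n) := (he.measurable_data n).mono (ℱ.le _) le_rfl

include he in
omit [CompleteSpace E] [BorelSpace E] [SecondCountableTopology E] in
lemma isProbabilityMeasure : IsProbabilityMeasure Q :=
  he.law 0 ▸ Measure.isProbabilityMeasure_map (he.measurable_data' 0).aemeasurable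

include he hS

omit [IsProbabilityMeasure P] in
lemma measurable (hg : ∀ n, 0 < g n) (n : ℕ) : Measurable[ℱ n] (e n) := by
  induction n with
  | zero => exact he.measurable_zero
  | succ n ih =>
    have h : e (n + 1) = (fun q : E × Z => implicitStep S (g n) q.2 q.1) ∘
        fun ω => (e n ω, ζ n ω) := by
      ext1 ω; exact he.step n ω
    rw [h]
    exact (hS.measurable_implicitStep (hg n).le).comp
      ((ih.mono (ℱ.mono n.le_succ) le_rfl).prodMk (he.measurable_data n))

omit [IsProbabilityMeasure P] [CompleteSpace E] [BorelSpace E] [SecondCountableTopology E] in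
lemma memLp_noise (n : ℕ) : MemLp (fun ω => S (ζ n ω) 0) 2 P :=
  MemLp.comp_measurePreserving (g := fun z => S z 0) hS.memLp ⟨he.measurable_data' n, he.law n⟩

omit [IsProbabilityMeasure P] [CompleteSpace E] [SecondCountableTopology E] in
lemma integral_norm_noise_sq (n : ℕ) :
    ∫ ω, ‖S (ζ n ω) 0‖ ^ 2 ∂P = ∫ z, ‖S z 0‖ ^ 2 ∂Q := by
  have h0 : Measurable fun z => S z 0 := hS.measurable.comp (measurable_id.prodMk measurable_const)
  rw [← he.law n, integral_map (he.measurable_data' n).aemeasurable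
    (h0.norm.pow_const 2).aestronglyMeasurable]

omit [IsProbabilityMeasure P] in
lemma memLp (hg : ∀ n, 0 < g n) (n : ℕ) : MemLp (e n) 2 P := by
  induction n with
  | zero => exact he.memLp_zero
  | succ n ih =>
    refine (ih.norm.add ((he.memLp_noise hS n).norm.const_mul (g n))).mono'
      ((he.measurable hS hg (n + 1)).mono (ℱ.le _) le_rfl).aestronglyMeasurable
      (ae_of_all _ fun ω => ?_)
    rw [he.step n ω]
    exact hS.norm_implicitStep_le' (hg n).le _ _

/-- One step contracts `e n + g n • ξ`, where the noise `ξ` is centred and independent of `e n`. -/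
lemma integral_norm_sq_succ_le (hg : ∀ n, 0 < g n) (n : ℕ) :
    ∫ ω, ‖e (n + 1) ω‖ ^ 2 ∂P ≤ (1 + lam * g n)⁻¹ *
      (∫ ω, ‖e n ω‖ ^ 2 ∂P + g n ^ 2 * ∫ z, ‖S z 0‖ ^ 2 ∂Q) := by
  have hQ := he.isProbabilityMeasure
  have hG : Measurable fun q : E × Z => g n • S q.2 0 :=
    (hS.measurable.comp (measurable_snd.prodMk measurable_const)).const_smul (g n)
  have h0 : ∫ z, g n • S z 0 ∂Q = 0 := by
    rw [integral_smul, hS.integral_eq_zero, smul_zero]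
  have hnoise : MemLp (fun ω => g n • S (ζ n ω) 0) 2 P := (he.memLp_noise hS n).const_smul (g n)
  have h := (memLp_add_increment_and_integral_le (ℱ.le n) (he.measurable_data' n) (he.indep n)
    (he.law n) (he.measurable hS hg n) (he.measurable hS hg n) (he.memLp hS hg n)
    (G := fun _ z => g n • S z 0) hG (fun _ => hS.memLp.const_smul (g n)) (c := fun _ => 0)
    measurable_const (by simpa using hnoise)).2
  simp only [h0, sub_zero, norm_smul, mul_pow, Real.norm_eq_abs, sq_abs] at h
  rw [integral_const_mul, he.integral_norm_noise_sq hS] at h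
  have hρ0 : 0 ≤ (1 + lam * g n)⁻¹ := by
    have := hS.lam_pos; have := hg n; positivity
  have hρ1 := hS.inv_one_add_le_one (hg n).le
  refine le_trans ?_ (mul_le_mul_of_nonneg_left h hρ0)
  rw [← integral_const_mul]
  refine integral_mono ((he.memLp hS hg (n + 1)).integrable_norm_pow two_ne_zero)
    ((((he.memLp hS hg n).add hnoise).integrable_norm_pow two_ne_zero).const_mul _) fun ω => ?_
  have h1 := hS.norm_implicitStep_le (hg n).le (ζ n ω) (e n ω)
  simp only
  rw [he.step n ω]
  calc ‖implicitStep S (g n) (ζ n ω) (e n ω)‖ ^ 2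
      ≤ ((1 + lam * g n)⁻¹ * ‖e n ω + g n • S (ζ n ω) 0‖) ^ 2 := by gcongr
    _ = (1 + lam * g n)⁻¹ * ((1 + lam * g n)⁻¹ * ‖e n ω + g n • S (ζ n ω) 0‖ ^ 2) := by ring
    _ ≤ (1 + lam * g n)⁻¹ * (1 * ‖e n ω + g n • S (ζ n ω) 0‖ ^ 2) := by gcongr
    _ = _ := by rw [one_mul]

end IsImplicitProcess

end StochasticApproximation

/-! ### Expected sums along the process -/

section AdditiveFunctional

variable {E Z : Type*} [NormedAddCommGroup E] [InnerProductSpace ℝ E] [CompleteSpace E]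
  [MeasurableSpace E] [BorelSpace E] [SecondCountableTopology E] [MeasurableSpace Z]
  {Q : Measure Z} {S : Z → E → E} {lam L : ℝ}

/-- The expected value, given that the process is at `x` at time `n`, of the sum
`r n (e n) + ⋯ + r (n + k - 1) (e (n + k - 1))` over the next `k` instants. -/
noncomputable def expectedSum (Q : Measure Z) (S : Z → E → E) (g : ℕ → ℝ) (r : ℕ → E → E) :
    ℕ → ℕ → E → E
  | 0, _ => fun _ => 0
  | k + 1, n => fun x =>
      r n x + ∫ z, expectedSum Q S g r k (n + 1) (implicitStep S (g n) z x) ∂Q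

variable {g t a : ℕ → ℝ} {C K : ℝ} {r : ℕ → E → E}

/-- Two copies of the process driven by the same data approach each other at the rate of the
contraction factors, the sum of whose products is bounded by `a n`. -/
lemma norm_expectedSum_sub_le [IsProbabilityMeasure Q] (hS : IsMonotoneField Q S lam L)
    (hg : ∀ n, 0 < g n) (ha : ∀ n, 0 < a n)
    (harec : ∀ n, 1 + (1 + lam * g n)⁻¹ * a (n + 1) ≤ a n) (hC : 0 ≤ C)
    (hr : ∀ n x y, ‖r n x - r n y‖ ≤ C * ‖x - y‖) (k n : ℕ) (x y : E) :
    ‖expectedSum Q S g r k n x - expectedSum Q S g r k n y‖ ≤ C * a n * ‖x - y‖ := by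
  induction k generalizing n x y with
  | zero =>
    have := ha n
    simp only [expectedSum, sub_self, norm_zero]
    positivity
  | succ k ih =>
    have hint : ∀ x, Integrable
        (fun z => expectedSum Q S g r k (n + 1) (implicitStep S (g n) z x)) Q := fun x =>
      (memLp_comp_of_norm_sub_le (hS.memLp_implicitStep (hg n).le x) (ih (n + 1))).integrable
        one_le_two
    have ha1 := ha (n + 1)
    have hgn := hg n
    have hlam := hS.lam_pos
    simp only [expectedSum]
    rw [add_sub_add_comm, ← integral_sub (hint x) (hint y)]
    calc _ ≤ ‖r n x - r n y‖ + _ := norm_add_le _ _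
      _ ≤ C * ‖x - y‖ + C * a (n + 1) * ((1 + lam * g n)⁻¹ * ‖x - y‖) := by
        refine add_le_add (hr n x y) ?_
        refine (norm_integral_le_of_norm_le_const (ae_of_all _ fun z =>
          (ih (n + 1) _ _).trans (mul_le_mul_of_nonneg_left
            (hS.norm_implicitStep_sub_le hgn.le z x y) (by positivity)))).trans ?_
        simp
      _ = C * (1 + (1 + lam * g n)⁻¹ * a (n + 1)) * ‖x - y‖ := by ring
      _ ≤ C * a n * ‖x - y‖ := by
        gcongr
        exact harec n

/-- If `r n` has a small Lipschitz constant `η n` near the origin, growing linearly with the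
distance, then `expectedSum` inherits this property, with quadratic growth: two copies of the
process driven by the same data approach each other at the rate of the contraction factors, and
their second moments stay bounded. -/
lemma norm_expectedSum_sub_le_local [IsProbabilityMeasure Q] (hS : IsMonotoneField Q S lam L)
    (hg : ∀ n, 0 < g n) (ha : ∀ n, 0 < a n)
    (harec : ∀ n, 1 + (1 + lam * g n)⁻¹ * a (n + 1) ≤ a n) (hK : 0 ≤ K)
    (haK : ∀ n, g n * a (n + 1) ≤ K) (hC : 0 ≤ C)
    (hr : ∀ n x y, ‖r n x - r n y‖ ≤ C * ‖x - y‖)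
    {η : ℕ → ℝ} (hη0 : ∀ n, 0 ≤ η n) (hη : Antitone η) {W : ℝ}
    (hrloc : ∀ n x y, ‖r n x - r n y‖ ≤ (η n + W * (‖x‖ + ‖y‖)) * ‖x - y‖)
    {ε : ℝ} (hε : 0 < ε) (k n : ℕ) (x y : E) :
    ‖expectedSum Q S g r k n x - expectedSum Q S g r k n y‖ ≤
      ((η n + ε) * a n + 2 * (W ^ 2 / (2 * ε)) * K * (∫ z, ‖S z 0‖ ^ 2 ∂Q) / lam
        + W ^ 2 / (2 * ε) * a n * (‖x‖ ^ 2 + ‖y‖ ^ 2)) * ‖x - y‖ := by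
  have hlam := hS.lam_pos
  set σ := ∫ z, ‖S z 0‖ ^ 2 ∂Q with hσ
  have hσ0 : 0 ≤ σ := integral_nonneg fun _ => sq_nonneg _
  set κ := W ^ 2 / (2 * ε) with hκ
  have hκ0 : 0 ≤ κ := by positivity
  set X := 2 * κ * K * σ / lam with hX
  have hX0 : 0 ≤ X := by positivity
  -- the linear growth of the Lipschitz constant is replaced by a quadratic one, because second
  -- moments, unlike first ones, increase only by `O(g n ^ 2)` in one step
  have hyoung : ∀ u : ℝ, W * u ≤ ε / 2 + κ * u ^ 2 := by
    intro u
    have h1 : ε / 2 + κ * u ^ 2 - W * u = (ε - W * u) ^ 2 / (2 * ε) := by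
      rw [hκ]; field_simp; ring
    have h2 : 0 ≤ (ε - W * u) ^ 2 / (2 * ε) := by positivity
    linarith
  induction k generalizing n x y with
  | zero =>
    have := ha n
    have := hη0 n
    simp only [expectedSum, sub_self, norm_zero]
    positivity
  | succ k ih =>
    have hint : ∀ x, Integrable
        (fun z => expectedSum Q S g r k (n + 1) (implicitStep S (g n) z x)) Q := fun x =>
      (memLp_comp_of_norm_sub_le (hS.memLp_implicitStep (hg n).le x)
        (norm_expectedSum_sub_le hS hg ha harec hC hr k (n + 1))).integrable one_le_two
    have ha1 := ha (n + 1)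
    have hgn := hg n
    have hη1 := hη0 (n + 1)
    have hsq : ∀ x, Integrable (fun z => ‖implicitStep S (g n) z x‖ ^ 2) Q := fun x =>
      (hS.memLp_implicitStep hgn.le x).integrable_norm_pow two_ne_zero
    set ρ := (1 + lam * g n)⁻¹ with hρ
    have hρ0 : 0 ≤ ρ := by positivity
    have hρX : ρ * (X + 2 * κ * K * σ * g n) = X := by
      rw [hρ, hX]; field_simp
    set A := (η (n + 1) + ε) * a (n + 1) + X with hA
    set B := κ * a (n + 1) with hB
    have hA0 : 0 ≤ A := by positivity
    have hB0 : 0 ≤ B := by positivity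
    simp only [expectedSum]
    rw [add_sub_add_comm, ← integral_sub (hint x) (hint y)]
    have hsum : Integrable (fun z => ‖implicitStep S (g n) z x‖ ^ 2
        + ‖implicitStep S (g n) z y‖ ^ 2) Q := (hsq x).add (hsq y)
    have h1 : ‖∫ z, (expectedSum Q S g r k (n + 1) (implicitStep S (g n) z x)
        - expectedSum Q S g r k (n + 1) (implicitStep S (g n) z y)) ∂Q‖ ≤
        (A + B * ((‖x‖ ^ 2 + g n ^ 2 * σ) + (‖y‖ ^ 2 + g n ^ 2 * σ))) * (ρ * ‖x - y‖) := by
      have h2 : Integrable (fun z => (A + B * (‖implicitStep S (g n) z x‖ ^ 2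
          + ‖implicitStep S (g n) z y‖ ^ 2)) * (ρ * ‖x - y‖)) Q :=
        ((integrable_const A).add (hsum.const_mul B)).mul_const _
      refine (norm_integral_le_of_norm_le h2 (ae_of_all _ fun z => ?_)).trans ?_
      · exact (ih (n + 1) _ _).trans (mul_le_mul_of_nonneg_left
          (hS.norm_implicitStep_sub_le hgn.le z x y) (by positivity))
      · rw [integral_mul_const, integral_add (integrable_const A) (hsum.const_mul B),
          integral_const_mul, integral_add (hsq x) (hsq y)]
        simp only [integral_const, probReal_univ, smul_eq_mul, one_mul]
        gcongr
        · exact hS.integral_norm_implicitStep_sq_le hgn.le x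
        · exact hS.integral_norm_implicitStep_sq_le hgn.le y
    have h3 : η n + W * (‖x‖ + ‖y‖) ≤ η n + ε + κ * (‖x‖ ^ 2 + ‖y‖ ^ 2) := by
      linarith [hyoung ‖x‖, hyoung ‖y‖]
    refine (norm_add_le _ _).trans ((add_le_add (hrloc n x y) h1).trans ?_)
    have h4 : η n + W * (‖x‖ + ‖y‖)
        + ρ * (A + B * ((‖x‖ ^ 2 + g n ^ 2 * σ) + (‖y‖ ^ 2 + g n ^ 2 * σ)))
        ≤ (η n + ε) * a n + X + κ * a n * (‖x‖ ^ 2 + ‖y‖ ^ 2) := by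
      have e1 : ρ * (X + 2 * κ * (g n * a (n + 1)) * σ * g n) ≤ X := by
        rw [← hρX]
        gcongr
        · rw [hρX]
        · exact haK n
      have e2 : (η n + ε + κ * (‖x‖ ^ 2 + ‖y‖ ^ 2)) * (1 + ρ * a (n + 1))
          ≤ (η n + ε + κ * (‖x‖ ^ 2 + ‖y‖ ^ 2)) * a n := by
        have := hη0 n
        gcongr
        exact harec n
      have e3 : ρ * (η (n + 1) * a (n + 1)) ≤ ρ * (η n * a (n + 1)) := by
        gcongr
        exact hη n.le_succ
      rw [hA, hB]
      linarith
    calc _ = (η n + W * (‖x‖ + ‖y‖)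
          + ρ * (A + B * ((‖x‖ ^ 2 + g n ^ 2 * σ) + (‖y‖ ^ 2 + g n ^ 2 * σ)))) * ‖x - y‖ := by ring
      _ ≤ _ := by gcongr

end AdditiveFunctional

/-! ### Negligible terms and uniform integrability -/

section Negligible

variable {E Ω : Type*} [NormedAddCommGroup E] [MeasurableSpace Ω] {P : Measure Ω}

/-- Random vectors `X n` that do not contribute to the variance of a sum of `n` terms: for a suitable
deterministic centring, their second moment is `o(n)`. -/
def IsNegligible (P : Measure Ω) (X : ℕ → Ω → E) : Prop :=
  (∀ n, MemLp (X n) 2 P) ∧ ∃ c : ℕ → E,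
    Tendsto (fun n : ℕ => (n : ℝ)⁻¹ * ∫ ω, ‖X n ω - c n‖ ^ 2 ∂P) atTop (𝓝 0)

lemma norm_add_sq_le_two_mul (x y : E) : ‖x + y‖ ^ 2 ≤ 2 * ‖x‖ ^ 2 + 2 * ‖y‖ ^ 2 := by
  have h := norm_add_le x y
  have h1 : ‖x + y‖ ^ 2 ≤ (‖x‖ + ‖y‖) ^ 2 := by gcongr
  nlinarith [sq_nonneg (‖x‖ - ‖y‖)]

lemma integral_norm_add_sq_le {X Y : Ω → E} (hX : MemLp X 2 P) (hY : MemLp Y 2 P) :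
    ∫ ω, ‖X ω + Y ω‖ ^ 2 ∂P ≤ 2 * ∫ ω, ‖X ω‖ ^ 2 ∂P + 2 * ∫ ω, ‖Y ω‖ ^ 2 ∂P := by
  have h1 := (hX.integrable_norm_pow two_ne_zero).const_mul 2
  have h2 := (hY.integrable_norm_pow two_ne_zero).const_mul 2
  rw [← integral_const_mul, ← integral_const_mul, ← integral_add h1 h2]
  exact integral_mono ((hX.add hY).integrable_norm_pow two_ne_zero) (h1.add h2)
    fun ω => norm_add_sq_le_two_mul _ _

variable [IsProbabilityMeasure P] {X Y : ℕ → Ω → E}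

lemma IsNegligible.add (hX : IsNegligible P X) (hY : IsNegligible P Y) :
    IsNegligible P fun n ω => X n ω + Y n ω := by
  obtain ⟨hX2, c, hc⟩ := hX
  obtain ⟨hY2, d, hd⟩ := hY
  refine ⟨fun n => (hX2 n).add (hY2 n), fun n => c n + d n, ?_⟩
  have hlim := (hc.const_mul 2).add (hd.const_mul 2)
  rw [mul_zero, add_zero] at hlim
  refine squeeze_zero (fun n => by positivity) (fun n => ?_) hlim
  have h := integral_norm_add_sq_le ((hX2 n).sub (memLp_const (c n)))
    ((hY2 n).sub (memLp_const (d n)))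
  simp only [Pi.sub_apply] at h
  have hn : (0 : ℝ) ≤ (n : ℝ)⁻¹ := by positivity
  calc (n : ℝ)⁻¹ * ∫ ω, ‖X n ω + Y n ω - (c n + d n)‖ ^ 2 ∂P
      = (n : ℝ)⁻¹ * ∫ ω, ‖(X n ω - c n) + (Y n ω - d n)‖ ^ 2 ∂P := by
        simp only [add_sub_add_comm]
    _ ≤ (n : ℝ)⁻¹ * (2 * ∫ ω, ‖X n ω - c n‖ ^ 2 ∂P + 2 * ∫ ω, ‖Y n ω - d n‖ ^ 2 ∂P) := by
        gcongr
    _ = _ := by ring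

omit [IsProbabilityMeasure P] in
lemma isNegligible_of_integral_le (hX : ∀ n, MemLp (X n) 2 P) {b : ℕ → ℝ}
    (hb : Tendsto (fun n : ℕ => (n : ℝ)⁻¹ * b n) atTop (𝓝 0))
    (h : ∀ n, ∫ ω, ‖X n ω‖ ^ 2 ∂P ≤ b n) : IsNegligible P X := by
  refine ⟨hX, fun _ => 0, squeeze_zero (fun n => by positivity) (fun n => ?_) hb⟩
  simp only [sub_zero]
  exact mul_le_mul_of_nonneg_left (h n) (by positivity)

end Negligible

section Tail

variable {E Z : Type*} [NormedAddCommGroup E] [MeasurableSpace Z] {Q : Measure Z}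

lemma tendsto_integral_indicator_norm_sq {X : Z → E} (hX : MemLp X 2 Q) :
    Tendsto (fun T : ℕ => ∫ z, (if (T : ℝ) < ‖X z‖ ^ 2 then ‖X z‖ ^ 2 else 0) ∂Q) atTop
      (𝓝 0) := by
  suffices h : Tendsto (fun T : ℕ => ∫ z, (if (T : ℝ) < ‖X z‖ ^ 2 then ‖X z‖ ^ 2 else 0) ∂Q) atTop
      (𝓝 (∫ _, (0 : ℝ) ∂Q)) by simpa using h
  have hsq := hX.integrable_norm_pow two_ne_zero
  refine tendsto_integral_of_dominated_convergence (fun z => ‖X z‖ ^ 2) (fun T => ?_) hsq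
    (fun T => ae_of_all _ fun z => ?_) (ae_of_all _ fun z => ?_)
  · have hm : AEMeasurable (fun z => ‖X z‖ ^ 2) Q := hsq.1.aemeasurable
    have h1 : Measurable fun s : ℝ => if (T : ℝ) < s then s else 0 :=
      Measurable.ite measurableSet_Ioi measurable_id measurable_const
    exact (h1.comp_aemeasurable hm).aestronglyMeasurable
  · split_ifs
    · simp
    · simp
  · refine tendsto_const_nhds.congr' ?_
    filter_upwards [tendsto_natCast_atTop_atTop.eventually_ge_atTop (‖X z‖ ^ 2)] with T hT
    rw [if_neg (not_lt.2 hT)]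

end Tail

section Martingale

variable {E Z Ω : Type*} [NormedAddCommGroup E] [InnerProductSpace ℝ E] [CompleteSpace E]
  [MeasurableSpace E] [BorelSpace E] [SecondCountableTopology E] [MeasurableSpace Z]
  {Q : Measure Z} {S : Z → E → E} {lam L : ℝ}
  {m0 : MeasurableSpace Ω} {P : Measure Ω} [IsProbabilityMeasure P] {g : ℕ → ℝ}
  {ℱ : Filtration ℕ m0} {ζ : ℕ → Ω → Z} {e : ℕ → Ω → E}

namespace IsImplicitProcess

variable (he : IsImplicitProcess P Q S g ℱ ζ e) (hS : IsMonotoneField Q S lam L)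
include he hS

/-- The second moment of a sum of martingale increments is at most the sum of their second moments,
even without centring. -/
lemma memLp_sum_increments (hg : ∀ n, 0 < g n) {G : ℕ → E → Z → E}
    (hG : ∀ i, Measurable fun q : E × Z => G i q.1 q.2) (hG2 : ∀ i a, MemLp (G i a) 2 Q)
    {c : ℕ → E → E} (hc : ∀ i, Measurable (c i))
    (hGc : ∀ i, MemLp (fun ω => G i (e i ω) (ζ i ω) - c i (e i ω)) 2 P) (n : ℕ) :
    MemLp (fun ω => ∑ i ∈ Finset.range n,
        (G i (e i ω) (ζ i ω) - ∫ z, G i (e i ω) z ∂Q)) 2 P ∧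
      ∫ ω, ‖∑ i ∈ Finset.range n, (G i (e i ω) (ζ i ω) - ∫ z, G i (e i ω) z ∂Q)‖ ^ 2 ∂P
        ≤ ∑ i ∈ Finset.range n, ∫ ω, ‖G i (e i ω) (ζ i ω) - c i (e i ω)‖ ^ 2 ∂P := by
  have hQ := he.isProbabilityMeasure
  have hmeas : ∀ n, Measurable[ℱ n] fun ω => ∑ i ∈ Finset.range n,
      (G i (e i ω) (ζ i ω) - ∫ z, G i (e i ω) z ∂Q) := by
    intro n
    refine Finset.measurable_fun_sum _ fun i hi => ?_
    have hin : i + 1 ≤ n := Finset.mem_range.1 hi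
    have h1 : Measurable[ℱ n] (e i) :=
      (he.measurable hS hg i).mono (ℱ.mono (by omega)) le_rfl
    have h2 : Measurable[ℱ n] (ζ i) := (he.measurable_data i).mono (ℱ.mono hin) le_rfl
    have hbar : Measurable fun a => ∫ z, G i a z ∂Q :=
      ((hG i).stronglyMeasurable.integral_prod_right (ν := Q)).measurable
    exact ((hG i).comp (h1.prodMk h2)).sub (hbar.comp h1)
  induction n with
  | zero => simp
  | succ n ih =>
    have h := memLp_add_increment_and_integral_le (ℱ.le n) (he.measurable_data' n) (he.indep n)
      (he.law n) (hmeas n) (he.measurable hS hg n) ih.1 (hG n) (hG2 n) (hc n) (hGc n)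
    simp only [Finset.sum_range_succ]
    exact ⟨h.1, h.2.trans (add_le_add ih.2 le_rfl)⟩

omit [BorelSpace E] [SecondCountableTopology E] [IsProbabilityMeasure P] in
lemma norm_succ_sub_le (hg : ∀ n, 0 < g n) (n : ℕ) (ω : Ω) :
    ‖e (n + 1) ω - e n ω‖ ≤ g n * (‖S (ζ n ω) 0‖ + L * ‖e (n + 1) ω‖) := by
  have h := hS.implicitStep_spec (hg n).le (ζ n ω) (e n ω)
  rw [← he.step n ω] at h
  have h1 : e (n + 1) ω - e n ω = g n • S (ζ n ω) (e (n + 1) ω) := by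
    rw [sub_eq_iff_eq_add']; exact h
  rw [h1, norm_smul, Real.norm_of_nonneg (hg n).le]
  exact mul_le_mul_of_nonneg_left (hS.norm_apply_le _ _) (hg n).le

/-- The increments of `v k (n + 1)` along one step of the process tend to zero in `L²`, uniformly
in `k`.  The step is of size `g n (‖ξ‖ + ‖e (n + 1)‖)`, where the noise `ξ` is uniformly square
integrable because its law is fixed, and it is multiplied by a Lipschitz constant of order `1 / g n`
that is also small where the process is close to the origin. -/
lemma exists_tendsto_bound_increment (hg : ∀ n, 0 < g n) (hg0 : Tendsto g atTop (𝓝 0))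
    (hsec : Tendsto (fun n => ∫ ω, ‖e n ω‖ ^ 2 ∂P) atTop (𝓝 0))
    {a : ℕ → ℝ} {C K : ℝ} (ha : ∀ n, 0 < a n) (hC : 0 ≤ C) (hK : 0 ≤ K)
    (haK : ∀ n, g n * a (n + 1) ≤ K) {η : ℕ → ℝ} (hη0 : ∀ n, 0 ≤ η n)
    (hη : Tendsto η atTop (𝓝 0)) {v : ℕ → ℕ → E → E}
    (hv : ∀ k n x y, ‖v k n x - v k n y‖ ≤ C * a n * ‖x - y‖)
    (hvloc : ∀ ε : ℝ, 0 < ε → ∃ B κ : ℝ, 0 ≤ B ∧ 0 ≤ κ ∧ ∀ k n x y, ‖v k n x - v k n y‖ ≤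
      ((η n + ε) * a n + B + κ * a n * (‖x‖ ^ 2 + ‖y‖ ^ 2)) * ‖x - y‖) :
    ∃ τ : ℕ → ℝ, Tendsto τ atTop (𝓝 0) ∧
      ∀ k n, ∫ ω, ‖v k (n + 1) (e (n + 1) ω) - v k (n + 1) (e n ω)‖ ^ 2 ∂P ≤ τ n := by
  have hL := hS.L_nonneg
  set s : ℕ → ℝ := fun n => ∫ ω, ‖e n ω‖ ^ 2 ∂P with hs
  set φ : ℕ → ℝ := fun T => ∫ z, (if (T : ℝ) < ‖S z 0‖ ^ 2 then ‖S z 0‖ ^ 2 else 0) ∂Q with hφ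
  set Δ : ℕ → ℕ → ℝ := fun n k =>
    ∫ ω, ‖v k (n + 1) (e (n + 1) ω) - v k (n + 1) (e n ω)‖ ^ 2 ∂P with hΔ
  set M := C * K with hM
  have hM0 : 0 ≤ M := by positivity
  have he2 : ∀ n, Integrable (fun ω => ‖e n ω‖ ^ 2) P := fun n =>
    (he.memLp hS hg n).integrable_norm_pow two_ne_zero
  -- the noise is split at level `T`: large values carry little mass, small ones are bounded
  have hbound : ∀ (T : ℕ) (ε : ℝ), 0 < ε → ∃ B κ : ℝ, ∀ n k, Δ n k ≤
      2 * M ^ 2 * L ^ 2 * s (n + 1) + 2 * M ^ 2 * φ T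
        + 2 * T * M * (K * (η (n + 1) + ε) + g n * B + κ * K * (s (n + 1) + s n)) := by
    intro T ε hε
    obtain ⟨B, κ, hB, hκ, hloc⟩ := hvloc ε hε
    refine ⟨B, κ, fun n k => ?_⟩
    have hgn := hg n
    have hη1 := hη0 (n + 1)
    have ha1 := ha (n + 1)
    set tail : Z → ℝ := fun z => if (T : ℝ) < ‖S z 0‖ ^ 2 then ‖S z 0‖ ^ 2 else 0 with htail
    have hS0 : Measurable fun z => S z 0 :=
      hS.measurable.comp (measurable_id.prodMk measurable_const)
    have htailm : Measurable tail :=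
      Measurable.ite (measurableSet_lt measurable_const (hS0.norm.pow_const 2))
        (hS0.norm.pow_const 2) measurable_const
    have htailint : Integrable (fun ω => tail (ζ n ω)) P := by
      refine ((he.memLp_noise hS n).integrable_norm_pow two_ne_zero).mono'
        (htailm.comp (he.measurable_data' n)).aestronglyMeasurable (ae_of_all _ fun ω => ?_)
      simp only [htail]
      split_ifs
      · simp
      · simp
    have htaileq : ∫ ω, tail (ζ n ω) ∂P = φ T := by
      rw [← integral_map (he.measurable_data' n).aemeasurable htailm.aestronglyMeasurable,
        he.law n]
    have hpt : ∀ ω, ‖v k (n + 1) (e (n + 1) ω) - v k (n + 1) (e n ω)‖ ^ 2 ≤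
        2 * M ^ 2 * L ^ 2 * ‖e (n + 1) ω‖ ^ 2 + 2 * M ^ 2 * tail (ζ n ω)
        + 2 * T * M * (K * (η (n + 1) + ε) + g n * B
            + κ * K * (‖e (n + 1) ω‖ ^ 2 + ‖e n ω‖ ^ 2)) := by
      intro ω
      set u := ‖S (ζ n ω) 0‖ with hu
      set b := ‖e (n + 1) ω‖ with hb
      set Y := K * (η (n + 1) + ε) + g n * B + κ * K * (b ^ 2 + ‖e n ω‖ ^ 2) with hY
      have hY0 : 0 ≤ Y := by positivity
      have hu0 : 0 ≤ u := norm_nonneg _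
      have hb0 : 0 ≤ b := norm_nonneg _
      have hstep := he.norm_succ_sub_le hS hg n ω
      set D := ‖v k (n + 1) (e (n + 1) ω) - v k (n + 1) (e n ω)‖ with hD
      have hD1 : D ≤ M * (u + L * b) := by
        calc D ≤ C * a (n + 1) * ‖e (n + 1) ω - e n ω‖ := hv k (n + 1) _ _
          _ ≤ C * a (n + 1) * (g n * (u + L * b)) := by gcongr
          _ = C * (g n * a (n + 1)) * (u + L * b) := by ring
          _ ≤ C * K * (u + L * b) := by gcongr; exact haK n
      have hD2 : D ≤ Y * (u + L * b) := by
        calc D ≤ ((η (n + 1) + ε) * a (n + 1) + B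
              + κ * a (n + 1) * (b ^ 2 + ‖e n ω‖ ^ 2)) * ‖e (n + 1) ω - e n ω‖ :=
              hloc k (n + 1) _ _
          _ ≤ ((η (n + 1) + ε) * a (n + 1) + B
              + κ * a (n + 1) * (b ^ 2 + ‖e n ω‖ ^ 2)) * (g n * (u + L * b)) := by gcongr
          _ = ((g n * a (n + 1)) * (η (n + 1) + ε) + g n * B
              + κ * (g n * a (n + 1)) * (b ^ 2 + ‖e n ω‖ ^ 2)) * (u + L * b) := by ring
          _ ≤ Y * (u + L * b) := by
            rw [hY]
            have := haK n
            gcongr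
      set q := min M Y with hq
      have hq0 : 0 ≤ q := le_min hM0 hY0
      have hub : 0 ≤ u + L * b := by positivity
      have hD3 : D ≤ q * (u + L * b) := by
        rcases min_choice M Y with h | h <;> rw [hq, h] <;> assumption
      have hDsq : D ^ 2 ≤ q ^ 2 * (2 * u ^ 2 + 2 * (L * b) ^ 2) := by
        calc D ^ 2 ≤ (q * (u + L * b)) ^ 2 := by gcongr
          _ = q ^ 2 * (u + L * b) ^ 2 := by ring
          _ ≤ q ^ 2 * (2 * u ^ 2 + 2 * (L * b) ^ 2) := by
            gcongr
            nlinarith [sq_nonneg (u - L * b)]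
      have hqM : q ^ 2 ≤ M ^ 2 := by gcongr; exact min_le_left _ _
      have hqMY : q ^ 2 ≤ M * Y := by
        rw [sq]
        exact mul_le_mul (min_le_left _ _) (min_le_right _ _) hq0 hM0
      have hsplit : q ^ 2 * u ^ 2 ≤ M ^ 2 * tail (ζ n ω) + T * (M * Y) := by
        simp only [htail]
        split_ifs with h
        · have : 0 ≤ (T : ℝ) * (M * Y) := by positivity
          have := mul_le_mul_of_nonneg_right hqM (sq_nonneg u)
          linarith
        · rw [mul_zero, zero_add, mul_comm (T : ℝ)]
          exact mul_le_mul hqMY (not_lt.1 h) (sq_nonneg _) (by positivity)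
      have h4 := mul_le_mul_of_nonneg_right hqM (sq_nonneg (L * b))
      calc D ^ 2 ≤ 2 * (q ^ 2 * u ^ 2) + 2 * (q ^ 2 * (L * b) ^ 2) := by linarith
        _ ≤ 2 * (M ^ 2 * tail (ζ n ω) + T * (M * Y)) + 2 * (M ^ 2 * (L * b) ^ 2) := by linarith
        _ = _ := by ring
    have i1 : Integrable (fun ω => 2 * M ^ 2 * L ^ 2 * ‖e (n + 1) ω‖ ^ 2) P :=
      (he2 (n + 1)).const_mul _
    have i2 : Integrable (fun ω => 2 * M ^ 2 * tail (ζ n ω)) P := htailint.const_mul _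
    have i3 : Integrable (fun ω => ‖e (n + 1) ω‖ ^ 2 + ‖e n ω‖ ^ 2) P := (he2 _).add (he2 _)
    have i4 : Integrable (fun ω => K * (η (n + 1) + ε) + g n * B
        + κ * K * (‖e (n + 1) ω‖ ^ 2 + ‖e n ω‖ ^ 2)) P :=
      (integrable_const _).add (i3.const_mul _)
    have i12 : Integrable (fun ω => 2 * M ^ 2 * L ^ 2 * ‖e (n + 1) ω‖ ^ 2
      + 2 * M ^ 2 * tail (ζ n ω)) P := i1.add i2
    have hint := integral_mono_of_nonneg (ae_of_all P fun ω => sq_nonneg _)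
      (i12.add (i4.const_mul (2 * T * M))) (ae_of_all P hpt)
    refine hint.trans_eq ?_
    rw [integral_add' i12 (i4.const_mul (2 * T * M)), integral_add i1 i2, integral_const_mul,
      integral_const_mul, integral_const_mul, integral_add (integrable_const _) (i3.const_mul _),
      integral_const_mul, integral_add (he2 _) (he2 _), htaileq]
    simp [hs]
  have hΔ0 : ∀ n k, 0 ≤ Δ n k := fun n k => integral_nonneg fun _ => sq_nonneg _
  have hbdd : ∀ n, BddAbove (Set.range (Δ n)) := by
    intro n
    obtain ⟨B, κ, h⟩ := hbound 0 1 one_pos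
    exact ⟨_, by rintro _ ⟨k, rfl⟩; exact h n k⟩
  refine ⟨fun n => ⨆ k, Δ n k, ?_, fun k n => le_ciSup (hbdd n) k⟩
  rw [Metric.tendsto_atTop']
  intro δ hδ
  have hφ0 : Tendsto φ atTop (𝓝 0) := tendsto_integral_indicator_norm_sq hS.memLp
  -- first the level `T` is chosen, then `ε` depending on `T`, then `n0`
  obtain ⟨T, hT⟩ : ∃ T : ℕ, 2 * M ^ 2 * φ T < δ / 2 := by
    have h := hφ0.const_mul (2 * M ^ 2)
    rw [mul_zero] at h
    exact (h.eventually_lt_const (half_pos hδ)).exists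
  obtain ⟨ε, hε, hTε⟩ : ∃ ε : ℝ, 0 < ε ∧ 2 * T * M * (K * ε) < δ / 2 := by
    have h : Tendsto (fun ε : ℝ => 2 * T * M * (K * ε)) (𝓝[>] 0) (𝓝 (2 * T * M * (K * 0))) :=
      (Continuous.tendsto (by fun_prop) 0).mono_left nhdsWithin_le_nhds
    rw [mul_zero, mul_zero] at h
    obtain ⟨ε, h1, h2⟩ := ((h.eventually_lt_const (half_pos hδ)).and
      self_mem_nhdsWithin).exists
    exact ⟨ε, h2, h1⟩
  obtain ⟨B, κ, hBκ⟩ := hbound T ε hε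
  have hlim : Tendsto (fun n => 2 * M ^ 2 * L ^ 2 * s (n + 1) + 2 * M ^ 2 * φ T
        + 2 * T * M * (K * (η (n + 1) + ε) + g n * B + κ * K * (s (n + 1) + s n))) atTop
      (𝓝 (2 * M ^ 2 * L ^ 2 * 0 + 2 * M ^ 2 * φ T
        + 2 * T * M * (K * (0 + ε) + 0 * B + κ * K * (0 + 0)))) := by
    have hs1 : Tendsto (fun n => s (n + 1)) atTop (𝓝 0) := hsec.comp (tendsto_add_atTop_nat 1)
    have hη1 : Tendsto (fun n => η (n + 1)) atTop (𝓝 0) := hη.comp (tendsto_add_atTop_nat 1)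
    exact ((hs1.const_mul _).add_const _).add (((((hη1.add_const ε).const_mul K).add
      (hg0.mul_const B)).add ((hs1.add hsec).const_mul (κ * K))).const_mul _)
  obtain ⟨n0, hn0⟩ := eventually_atTop.1 (hlim.eventually_lt_const (show _ < δ by
    simp only [mul_zero, zero_add, zero_mul, add_zero]
    linarith))
  refine ⟨n0, fun n hn => ?_⟩
  rw [Real.dist_0_eq_abs, abs_of_nonneg (Real.iSup_nonneg fun k => hΔ0 n k)]
  exact (ciSup_le fun k => hBκ n k).trans_lt (hn0 n hn.le)

end IsImplicitProcess

end Martingale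

/-! ### The mean drift and the linearised sum of the iterates -/

section MeanDrift

variable {E Z : Type*} [NormedAddCommGroup E] [InnerProductSpace ℝ E] [CompleteSpace E]
  [MeasurableSpace E] [BorelSpace E] [SecondCountableTopology E] [MeasurableSpace Z]
  {Q : Measure Z} {S : Z → E → E} {lam L : ℝ}

/-- Near the origin the field `S z` is approximated, up to second order terms with integrable
constant `M z`, by the bounded linear map `-B z`, whose mean is `-A`. -/
structure HasLinearPart (Q : Measure Z) (S : Z → E → E) (L : ℝ) (B : Z → E →L[ℝ] E)
    (A : E →L[ℝ] E) (M : Z → ℝ) : Prop where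
  norm_le : ∀ z, ‖B z‖ ≤ L
  integrable : ∀ x, Integrable (fun z => B z x) Q
  integral : ∀ x, ∫ z, B z x ∂Q = A x
  integrable_bound : Integrable M Q
  bound_nonneg : ∀ z, 0 ≤ M z
  remainder : ∀ z a b, ‖S z a - S z b + B z (a - b)‖ ≤ M z * max ‖a‖ ‖b‖ * ‖a - b‖

/-- The mean of the increment, divided by the step size `g`, of the implicit step from `x`. -/
noncomputable def meanDrift (Q : Measure Z) (S : Z → E → E) (g : ℝ) (x : E) : E :=
  ∫ z, S z (implicitStep S g z x) ∂Q

/-- The local Lipschitz constant at the origin of the nonlinear part of `meanDrift`. -/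
noncomputable def driftModulus (Q : Measure Z) (S : Z → E → E) (L : ℝ) (M : Z → ℝ) (g : ℝ) : ℝ :=
  ∫ z, min (2 * L) (g * (M z * ‖S z 0‖)) ∂Q + g * L ^ 2

variable [IsProbabilityMeasure Q] {g : ℝ} {B : Z → E →L[ℝ] E} {A : E →L[ℝ] E} {M : Z → ℝ}

lemma memLp_apply_implicitStep (hS : IsMonotoneField Q S lam L) (hg : 0 ≤ g) (x : E) :
    MemLp (fun z => S z (implicitStep S g z x)) 2 Q := by
  refine (hS.memLp.norm.add ((hS.memLp_implicitStep hg x).norm.const_mul L)).mono'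
    (hS.measurable.comp (measurable_id.prodMk ((hS.measurable_implicitStep hg).comp
      (measurable_const.prodMk measurable_id)))).aestronglyMeasurable
    (ae_of_all _ fun z => hS.norm_apply_le _ _)

omit [CompleteSpace E] [BorelSpace E] [SecondCountableTopology E] in
lemma integrable_min_noise (hS : IsMonotoneField Q S lam L) (hM : HasLinearPart Q S L B A M)
    (hg : 0 ≤ g) : Integrable (fun z => min (2 * L) (g * (M z * ‖S z 0‖))) Q := by
  have hL := hS.L_nonneg
  refine (integrable_const (2 * L)).mono' ?_ (ae_of_all _ fun z => ?_)
  · exact (aestronglyMeasurable_const).inf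
      ((hM.integrable_bound.1.mul hS.memLp.1.norm).const_mul g)
  · have := hM.bound_nonneg z
    rw [Real.norm_of_nonneg (le_min (by positivity) (by positivity))]
    exact min_le_left _ _

omit [CompleteSpace E] [BorelSpace E] [SecondCountableTopology E] [IsProbabilityMeasure Q] in
lemma driftModulus_nonneg (hS : IsMonotoneField Q S lam L) (hM : HasLinearPart Q S L B A M)
    (hg : 0 ≤ g) : 0 ≤ driftModulus Q S L M g := by
  have hL := hS.L_nonneg
  refine add_nonneg (integral_nonneg fun z => ?_) (by positivity)
  have := hM.bound_nonneg z
  exact le_min (by positivity) (by positivity)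

omit [CompleteSpace E] [BorelSpace E] [SecondCountableTopology E] in
lemma driftModulus_mono (hS : IsMonotoneField Q S lam L) (hM : HasLinearPart Q S L B A M)
    {g' : ℝ} (hg : 0 ≤ g) (hgg : g ≤ g') : driftModulus Q S L M g ≤ driftModulus Q S L M g' := by
  refine add_le_add (integral_mono (integrable_min_noise hS hM hg)
    (integrable_min_noise hS hM (hg.trans hgg)) fun z => ?_) (by gcongr)
  have := hM.bound_nonneg z
  exact min_le_min_left _ (by gcongr)

omit [CompleteSpace E] [BorelSpace E] [SecondCountableTopology E] in
/-- Dominated convergence; no integrability of the product of `M z` and the noise is needed. -/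
lemma tendsto_driftModulus (hS : IsMonotoneField Q S lam L) (hM : HasLinearPart Q S L B A M)
    {g : ℕ → ℝ} (hg : ∀ n, 0 < g n) (hg0 : Tendsto g atTop (𝓝 0)) :
    Tendsto (fun n => driftModulus Q S L M (g n)) atTop (𝓝 0) := by
  have hL := hS.L_nonneg
  have h1 : Tendsto (fun n => ∫ z, min (2 * L) (g n * (M z * ‖S z 0‖)) ∂Q) atTop
      (𝓝 (∫ _, (0 : ℝ) ∂Q)) := by
    refine tendsto_integral_of_dominated_convergence (fun _ => 2 * L)
      (fun n => (integrable_min_noise hS hM (hg n).le).1) (integrable_const _)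
      (fun n => ae_of_all _ fun z => ?_) (ae_of_all _ fun z => ?_)
    · have := hM.bound_nonneg z
      have := hg n
      rw [Real.norm_of_nonneg (le_min (by positivity) (by positivity))]
      exact min_le_left _ _
    · have h2 := (tendsto_const_nhds (x := 2 * L)).min (hg0.mul_const (M z * ‖S z 0‖))
      rwa [zero_mul, min_eq_right (by positivity)] at h2
  have h3 := h1.add (hg0.mul_const (L ^ 2))
  simpa [driftModulus] using h3

omit [MeasurableSpace E] [BorelSpace E] [SecondCountableTopology E] [CompleteSpace E] in
lemma HasLinearPart.norm_apply_le (hM : HasLinearPart Q S L B A M) (x : E) :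
    ‖A x‖ ≤ L * ‖x‖ := by
  rw [← hM.integral x]
  have h : ∀ z, ‖B z x‖ ≤ L * ‖x‖ := fun z =>
    ((B z).le_opNorm x).trans (by gcongr; exact hM.norm_le z)
  simpa using norm_integral_le_of_norm_le_const (μ := Q) (ae_of_all _ h)

lemma norm_meanDrift_add_sub_le (hS : IsMonotoneField Q S lam L)
    (hM : HasLinearPart Q S L B A M) (hg : 0 ≤ g) (x y : E) :
    ‖(meanDrift Q S g x + A x) - (meanDrift Q S g y + A y)‖ ≤ 2 * L * ‖x - y‖ := by
  have hint := fun x => (memLp_apply_implicitStep hS hg x).integrable one_le_two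
  have h1 : ‖meanDrift Q S g x - meanDrift Q S g y‖ ≤ L * ‖x - y‖ := by
    rw [meanDrift, meanDrift, ← integral_sub (hint x) (hint y)]
    have h : ∀ z, ‖S z (implicitStep S g z x) - S z (implicitStep S g z y)‖ ≤ L * ‖x - y‖ :=
      fun z => (hS.lipschitz z _ _).trans
        (mul_le_mul_of_nonneg_left (hS.norm_implicitStep_sub_le' hg z x y) hS.L_nonneg)
    simpa using norm_integral_le_of_norm_le_const (μ := Q) (ae_of_all _ h)
  have h2 : ‖A x - A y‖ ≤ L * ‖x - y‖ := by
    rw [← map_sub]; exact hM.norm_apply_le _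
  rw [add_sub_add_comm]
  linarith [norm_add_le (meanDrift Q S g x - meanDrift Q S g y) (A x - A y)]

lemma norm_meanDrift_add_sub_le_local (hS : IsMonotoneField Q S lam L)
    (hM : HasLinearPart Q S L B A M) (hg : 0 ≤ g) (x y : E) :
    ‖(meanDrift Q S g x + A x) - (meanDrift Q S g y + A y)‖ ≤
      (driftModulus Q S L M g + (∫ z, M z ∂Q) * (‖x‖ + ‖y‖)) * ‖x - y‖ := by
  have hL := hS.L_nonneg
  have hint := fun x => (memLp_apply_implicitStep hS hg x).integrable one_le_two
  have heq : (meanDrift Q S g x + A x) - (meanDrift Q S g y + A y)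
      = ∫ z, (S z (implicitStep S g z x) - S z (implicitStep S g z y) + B z (x - y)) ∂Q := by
    have hsub : Integrable
        (fun z => S z (implicitStep S g z x) - S z (implicitStep S g z y)) Q :=
      (hint x).sub (hint y)
    rw [integral_add hsub (hM.integrable _), integral_sub (hint x) (hint y),
      hM.integral, map_sub, meanDrift, meanDrift]
    abel
  have i1 := integrable_min_noise hS hM hg
  have i2 : Integrable (fun z => min (2 * L) (g * (M z * ‖S z 0‖)) + g * L ^ 2) Q :=
    i1.add (integrable_const _)
  have i3 : Integrable (fun z => M z * (‖x‖ + ‖y‖)) Q := hM.integrable_bound.mul_const _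
  rw [heq]
  refine (norm_integral_le_of_norm_le ((i2.add i3).mul_const ‖x - y‖)
    (ae_of_all _ fun z => ?_)).trans_eq ?_
  · have hMz := hM.bound_nonneg z
    set F := implicitStep S g z x with hF
    set F' := implicitStep S g z y with hF'
    have hFF : ‖F - F'‖ ≤ ‖x - y‖ := hS.norm_implicitStep_sub_le' hg z x y
    have hxy : x - y = (F - F') - g • (S z F - S z F') := by
      have h1 := hS.implicitStep_spec hg z x
      have h2 := hS.implicitStep_spec hg z y
      rw [← hF] at h1
      rw [← hF'] at h2
      rw [smul_sub]
      nth_rw 1 [h1, h2]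
      abel
    have hsplit : S z F - S z F' + B z (x - y)
        = (S z F - S z F' + B z (F - F')) - B z (g • (S z F - S z F')) := by
      rw [hxy, map_sub (B z)]; abel
    have hBv : ∀ v, ‖B z v‖ ≤ L * ‖v‖ := fun v =>
      ((B z).le_opNorm v).trans (by gcongr; exact hM.norm_le z)
    have hlip := hS.lipschitz z F F'
    have e1 : ‖S z F - S z F' + B z (F - F')‖
        ≤ (M z * (‖x‖ + ‖y‖) + min (2 * L) (g * (M z * ‖S z 0‖))) * ‖F - F'‖ := by
      have c1 : ‖S z F - S z F' + B z (F - F')‖ ≤ 2 * L * ‖F - F'‖ := by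
        linarith [norm_add_le (S z F - S z F') (B z (F - F')), hBv (F - F')]
      have hmax : max ‖F‖ ‖F'‖ ≤ ‖x‖ + ‖y‖ + g * ‖S z 0‖ := by
        have hx := hS.norm_implicitStep_le' hg z x
        have hy := hS.norm_implicitStep_le' hg z y
        refine max_le ?_ ?_
        · linarith [norm_nonneg y]
        · linarith [norm_nonneg x]
      have c2 : ‖S z F - S z F' + B z (F - F')‖
          ≤ (M z * (‖x‖ + ‖y‖) + g * (M z * ‖S z 0‖)) * ‖F - F'‖ := by
        refine (hM.remainder z F F').trans ?_
        gcongr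
        calc M z * max ‖F‖ ‖F'‖ ≤ M z * (‖x‖ + ‖y‖ + g * ‖S z 0‖) := by gcongr
          _ = _ := by ring
      rcases min_choice (2 * L) (g * (M z * ‖S z 0‖)) with h | h
      · rw [h]
        refine c1.trans ?_
        gcongr
        have : 0 ≤ M z * (‖x‖ + ‖y‖) := by positivity
        linarith
      · rw [h]; exact c2
    have e2 : ‖B z (g • (S z F - S z F'))‖ ≤ g * L ^ 2 * ‖F - F'‖ := by
      refine (hBv _).trans ?_
      rw [norm_smul, Real.norm_of_nonneg hg]
      calc L * (g * ‖S z F - S z F'‖) ≤ L * (g * (L * ‖F - F'‖)) := by gcongr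
        _ = _ := by ring
    have hmin : 0 ≤ min (2 * L) (g * (M z * ‖S z 0‖)) := le_min (by positivity) (by positivity)
    calc ‖S z F - S z F' + B z (x - y)‖
        ≤ ‖S z F - S z F' + B z (F - F')‖ + ‖B z (g • (S z F - S z F'))‖ := by
          rw [hsplit]; exact norm_sub_le _ _
      _ ≤ (min (2 * L) (g * (M z * ‖S z 0‖)) + g * L ^ 2 + M z * (‖x‖ + ‖y‖)) * ‖F - F'‖ := by
          linarith
      _ ≤ (min (2 * L) (g * (M z * ‖S z 0‖)) + g * L ^ 2 + M z * (‖x‖ + ‖y‖)) * ‖x - y‖ := by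
          gcongr
  · rw [integral_mul_const, integral_add' i2 i3, integral_add i1 (integrable_const _),
      integral_mul_const (‖x‖ + ‖y‖) M]
    simp [driftModulus]

end MeanDrift

section Negligible

variable {E Z Ω : Type*} [NormedAddCommGroup E] [InnerProductSpace ℝ E] [CompleteSpace E]
  [MeasurableSpace E] [BorelSpace E] [SecondCountableTopology E] [MeasurableSpace Z]
  {Q : Measure Z} {S : Z → E → E} {lam L : ℝ}
  {m0 : MeasurableSpace Ω} {P : Measure Ω} [IsProbabilityMeasure P] {g t : ℕ → ℝ} {C : ℝ}
  {ℱ : Filtration ℕ m0} {ζ : ℕ → Ω → Z} {e : ℕ → Ω → E}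
  {B : Z → E →L[ℝ] E} {A : E →L[ℝ] E} {M : Z → ℝ}

lemma tendsto_inv_natCast_mul_const (c : ℝ) :
    Tendsto (fun n : ℕ => (n : ℝ)⁻¹ * c) atTop (𝓝 0) := by
  have h := tendsto_inv_atTop_nhds_zero_nat (𝕜 := ℝ).mul_const c
  rwa [zero_mul] at h

namespace IsImplicitProcess

variable (he : IsImplicitProcess P Q S g ℱ ζ e) (hS : IsMonotoneField Q S lam L)
  (hg : IsStepSize g t lam C)
include he hS hg

lemma exists_integral_norm_sq_le :
    ∃ D, 0 ≤ D ∧ ∀ n, ∫ ω, ‖e n ω‖ ^ 2 ∂P ≤ D * g n :=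
  hg.exists_le_mul_of_recursion hS.lam_pos (integral_nonneg fun _ => sq_nonneg _)
    (integral_nonneg fun _ => sq_nonneg _) (he.integral_norm_sq_succ_le hS hg.pos)

lemma tendsto_integral_norm_sq :
    Tendsto (fun n => ∫ ω, ‖e n ω‖ ^ 2 ∂P) atTop (𝓝 0) := by
  obtain ⟨D, -, hD⟩ := he.exists_integral_norm_sq_le hS hg
  have h := hg.tendsto.const_mul D
  rw [mul_zero] at h
  exact squeeze_zero (fun n => integral_nonneg fun _ => sq_nonneg _) hD h

/-- Additive functionals of the process are negligible if the summands have, near the origin, small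
Lipschitz constants.  The martingale decomposition with `expectedSum` shows that their variance is
of the order of the sum of the second moments of the increments of `expectedSum`. -/
lemma isNegligible_sum {r : ℕ → E → E} {C' : ℝ} (hC' : 0 ≤ C')
    (hr : ∀ n x y, ‖r n x - r n y‖ ≤ C' * ‖x - y‖)
    {η : ℕ → ℝ} (hη0 : ∀ n, 0 ≤ η n) (hηanti : Antitone η) (hη : Tendsto η atTop (𝓝 0)) {W : ℝ}
    (hrloc : ∀ n x y, ‖r n x - r n y‖ ≤ (η n + W * (‖x‖ + ‖y‖)) * ‖x - y‖) :
    IsNegligible P fun n ω => ∑ j ∈ Finset.range n, r j (e j ω) := by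
  have hQ := he.isProbabilityMeasure
  have hlam := hS.lam_pos
  obtain ⟨a, K, hK, ha, harec, haK⟩ := hg.exists_potential hlam
  set v := expectedSum Q S g r with hvdef
  have hv : ∀ k n x y, ‖v k n x - v k n y‖ ≤ C' * a n * ‖x - y‖ :=
    norm_expectedSum_sub_le hS hg.pos ha harec hC' hr
  have hvm : ∀ k n, Measurable (v k n) := fun k n => measurable_of_norm_sub_le (hv k n)
  have he2 := he.memLp hS hg.pos
  obtain ⟨τ, hτ, hτle⟩ := he.exists_tendsto_bound_increment hS hg.pos hg.tendsto
    (he.tendsto_integral_norm_sq hS hg) ha hC' hK.le haK hη0 hη hv (fun ε hε => by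
      refine ⟨2 * (W ^ 2 / (2 * ε)) * K * (∫ z, ‖S z 0‖ ^ 2 ∂Q) / lam, W ^ 2 / (2 * ε), ?_,
        by positivity, norm_expectedSum_sub_le_local hS hg.pos ha harec hK.le haK hC' hr hη0
          hηanti hrloc hε⟩
      have : 0 ≤ ∫ z, ‖S z 0‖ ^ 2 ∂Q := integral_nonneg fun _ => sq_nonneg _
      positivity)
  set T : ℕ → Ω → E := fun n ω => ∑ i ∈ Finset.range n,
    (v (n - (i + 1)) (i + 1) (implicitStep S (g i) (ζ i ω) (e i ω))
      - ∫ z, v (n - (i + 1)) (i + 1) (implicitStep S (g i) z (e i ω)) ∂Q) with hT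
  have hdecomp : ∀ n ω, ∑ j ∈ Finset.range n, r j (e j ω) = v n 0 (e 0 ω) + T n ω := by
    intro n ω
    have h1 : ∀ i ∈ Finset.range n, r i (e i ω)
        = (v (n - i) i (e i ω) - v (n - (i + 1)) (i + 1) (e (i + 1) ω))
          + (v (n - (i + 1)) (i + 1) (implicitStep S (g i) (ζ i ω) (e i ω))
            - ∫ z, v (n - (i + 1)) (i + 1) (implicitStep S (g i) z (e i ω)) ∂Q) := by
      intro i hi
      have h2 : n - i = (n - (i + 1)) + 1 := by
        have := Finset.mem_range.1 hi
        omega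
      rw [h2, ← he.step i ω]
      simp only [hvdef, expectedSum]
      abel
    rw [Finset.sum_congr rfl h1, Finset.sum_add_distrib,
      Finset.sum_range_sub' fun i => v (n - i) i (e i ω)]
    simp [hvdef, expectedSum, hT]
  have hTbound : ∀ n, MemLp (T n) 2 P ∧
      ∫ ω, ‖T n ω‖ ^ 2 ∂P ≤ ∑ i ∈ Finset.range n, τ i := by
    intro n
    have h := he.memLp_sum_increments hS hg.pos
      (G := fun i x z => v (n - (i + 1)) (i + 1) (implicitStep S (g i) z x))
      (fun i => (hvm _ _).comp (hS.measurable_implicitStep (hg.pos i).le))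
      (fun i x => memLp_comp_of_norm_sub_le (hS.memLp_implicitStep (hg.pos i).le x) (hv _ _))
      (c := fun i => v (n - (i + 1)) (i + 1)) (fun i => hvm _ _)
      (fun i => by
        simp only [← he.step i]
        exact (memLp_comp_of_norm_sub_le (he2 (i + 1)) (hv _ _)).sub
          (memLp_comp_of_norm_sub_le (he2 i) (hv _ _))) n
    refine ⟨h.1, h.2.trans (Finset.sum_le_sum fun i _ => ?_)⟩
    simp only [← he.step i]
    exact hτle _ _
  refine ⟨fun n => ?_, fun n => v n 0 0, ?_⟩
  · exact memLp_finsetSum _ fun j _ => memLp_comp_of_norm_sub_le (he2 j) (hr j)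
  · have hlim : Tendsto (fun n : ℕ => (n : ℝ)⁻¹ * (2 * ((C' * a 0) ^ 2 * ∫ ω, ‖e 0 ω‖ ^ 2 ∂P))
        + 2 * ((n : ℝ)⁻¹ * ∑ i ∈ Finset.range n, τ i)) atTop (𝓝 (0 * _ + 2 * 0)) :=
      (tendsto_inv_atTop_nhds_zero_nat.mul_const _).add (hτ.cesaro.const_mul 2)
    rw [zero_mul, mul_zero, add_zero] at hlim
    refine squeeze_zero (fun n => by positivity) (fun n => ?_) hlim
    have h0 : MemLp (fun ω => v n 0 (e 0 ω) - v n 0 0) 2 P :=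
      (memLp_comp_of_norm_sub_le (he2 0) (hv _ _)).sub (memLp_const _)
    have h1 : ∫ ω, ‖v n 0 (e 0 ω) - v n 0 0‖ ^ 2 ∂P
        ≤ (C' * a 0) ^ 2 * ∫ ω, ‖e 0 ω‖ ^ 2 ∂P := by
      rw [← integral_const_mul]
      refine integral_mono (h0.integrable_norm_pow two_ne_zero)
        (((he2 0).integrable_norm_pow two_ne_zero).const_mul _) fun ω => ?_
      simp only
      rw [← mul_pow]
      gcongr
      simpa using hv n 0 (e 0 ω) 0
    have h2 := integral_norm_add_sq_le h0 (hTbound n).1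
    have h3 : ∫ ω, ‖∑ j ∈ Finset.range n, r j (e j ω) - v n 0 0‖ ^ 2 ∂P
        ≤ 2 * ((C' * a 0) ^ 2 * ∫ ω, ‖e 0 ω‖ ^ 2 ∂P) + 2 * ∑ i ∈ Finset.range n, τ i := by
      have h4 : ∀ ω, ∑ j ∈ Finset.range n, r j (e j ω) - v n 0 0
          = (v n 0 (e 0 ω) - v n 0 0) + T n ω := fun ω => by rw [hdecomp]; abel
      simp only [h4]
      linarith [(hTbound n).2]
    calc _ ≤ (n : ℝ)⁻¹ * (2 * ((C' * a 0) ^ 2 * ∫ ω, ‖e 0 ω‖ ^ 2 ∂P)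
          + 2 * ∑ i ∈ Finset.range n, τ i) := by gcongr
      _ = _ := by ring

/-- Summation by parts: the increments divided by the step sizes sum up to `e n / g n`, which is
`O((g n)^(-1/2))` in `L²`, and terms of the same order. -/
lemma isNegligible_sum_increments :
    IsNegligible P fun n ω =>
      -∑ j ∈ Finset.range n, (g j)⁻¹ • (e (j + 1) ω - e j ω) := by
  obtain ⟨D, hD0, hD⟩ := he.exists_integral_norm_sq_le hS hg
  have he2 := he.memLp hS hg.pos
  set h : ℕ → ℝ := fun n => (√(g n))⁻¹ with hh
  have hpos : ∀ n, 0 < h n := fun n => inv_pos.2 (Real.sqrt_pos.2 (hg.pos n))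
  have hsq : ∀ n, h n ^ 2 = (g n)⁻¹ := fun n => by
    rw [hh]; simp only; rw [inv_pow, Real.sq_sqrt (hg.pos n).le]
  have hmono : ∀ n, h n ≤ h (n + 1) := fun n =>
    inv_anti₀ (Real.sqrt_pos.2 (hg.pos _)) (Real.sqrt_le_sqrt (hg.antitone n.le_succ))
  set w : ℕ → ℝ := fun j => h (j + 1) ^ 2 - h j ^ 2 with hw
  have hw0 : ∀ j, 0 ≤ w j := fun j => sub_nonneg.2 (by have := hmono j; have := hpos j; gcongr)
  have habel : ∀ n ω, -∑ j ∈ Finset.range n, (g j)⁻¹ • (e (j + 1) ω - e j ω)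
      = (-(g n)⁻¹ • e n ω + (g 0)⁻¹ • e 0 ω) + ∑ j ∈ Finset.range n, w j • e (j + 1) ω := by
    intro n ω
    induction n with
    | zero => simp
    | succ n ih =>
      rw [Finset.sum_range_succ, neg_add, ih, Finset.sum_range_succ, hw]
      simp only [hsq]
      module
  -- `(h (j + 1) ^ 2 - h j ^ 2) / h (j + 1) ≤ 2 * (h (j + 1) - h j)`, which telescopes
  have hsum : ∀ n, ∑ j ∈ Finset.range n, w j * (h (j + 1))⁻¹ ≤ 2 * h n := by
    intro n
    induction n with
    | zero => simpa using (hpos 0).le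
    | succ n ih =>
      rw [Finset.sum_range_succ]
      have h1 : w n * (h (n + 1))⁻¹ ≤ 2 * (h (n + 1) - h n) := by
        rw [mul_inv_le_iff₀ (hpos _)]
        have := hmono n
        have := hpos n
        simp only [hw]
        nlinarith
      linarith
  -- Cauchy-Schwarz with the weights `w j`
  have hcs : ∀ n ω, ‖∑ j ∈ Finset.range n, w j • e (j + 1) ω‖ ^ 2 ≤
      2 * h n * ∑ j ∈ Finset.range n, w j * h (j + 1) * ‖e (j + 1) ω‖ ^ 2 := by
    intro n ω
    have h1 : ‖∑ j ∈ Finset.range n, w j • e (j + 1) ω‖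
        ≤ ∑ j ∈ Finset.range n, w j * ‖e (j + 1) ω‖ := by
      refine (norm_sum_le _ _).trans_eq (Finset.sum_congr rfl fun j _ => ?_)
      rw [norm_smul, Real.norm_of_nonneg (hw0 j)]
    have h2 := Finset.sum_sq_le_sum_mul_sum_of_sq_le_mul (Finset.range n)
      (r := fun j => w j * ‖e (j + 1) ω‖) (f := fun j => w j * (h (j + 1))⁻¹)
      (g := fun j => w j * h (j + 1) * ‖e (j + 1) ω‖ ^ 2)
      (fun j _ => by have := hw0 j; have := hpos (j + 1); positivity)
      (fun j _ => by have := hw0 j; have := hpos (j + 1); positivity)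
      (fun j _ => by have := (hpos (j + 1)).ne'; field_simp; rfl)
    calc _ ≤ (∑ j ∈ Finset.range n, w j * ‖e (j + 1) ω‖) ^ 2 := by gcongr
      _ ≤ _ := h2
      _ ≤ _ := by
        refine mul_le_mul_of_nonneg_right (hsum n) (Finset.sum_nonneg fun j _ => ?_)
        have := hw0 j; have := hpos (j + 1); positivity
  have hlast : IsNegligible P fun n ω => ∑ j ∈ Finset.range n, w j • e (j + 1) ω := by
    have hmem : ∀ n, MemLp (fun ω => ∑ j ∈ Finset.range n, w j • e (j + 1) ω) 2 P := fun n =>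
      memLp_finsetSum _ fun j _ => (he2 (j + 1)).const_smul (w j)
    refine isNegligible_of_integral_le hmem (b := fun n => 4 * D * (g n)⁻¹) ?_ fun n => ?_
    · have := hg.tendsto_mul.const_mul (4 * D)
      rw [mul_zero] at this
      refine this.congr fun n => by ring
    · have hi : ∀ j, Integrable (fun ω => w j * h (j + 1) * ‖e (j + 1) ω‖ ^ 2) P := fun j =>
        ((he2 (j + 1)).integrable_norm_pow two_ne_zero).const_mul _
      refine (integral_mono ((hmem n).integrable_norm_pow two_ne_zero)
        ((integrable_finsetSum (Finset.range n) fun j _ => hi j).const_mul (2 * h n))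
        (hcs n)).trans ?_
      rw [integral_const_mul, integral_finsetSum _ fun j _ => hi j]
      have h1 : ∀ j, ∫ ω, w j * h (j + 1) * ‖e (j + 1) ω‖ ^ 2 ∂P ≤ D * (w j * (h (j + 1))⁻¹) := by
        intro j
        have hp := hpos (j + 1)
        rw [integral_const_mul]
        calc w j * h (j + 1) * ∫ ω, ‖e (j + 1) ω‖ ^ 2 ∂P
            ≤ w j * h (j + 1) * (D * g (j + 1)) := by
              have := hw0 j
              gcongr
              exact hD _
          _ = D * (w j * (h (j + 1))⁻¹) := by
              have h3 : g (j + 1) = (h (j + 1) ^ 2)⁻¹ := by rw [hsq, inv_inv]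
              rw [h3]; field_simp
      have hn := hpos n
      calc 2 * h n * ∑ j ∈ Finset.range n, ∫ ω, w j * h (j + 1) * ‖e (j + 1) ω‖ ^ 2 ∂P
          ≤ 2 * h n * ∑ j ∈ Finset.range n, D * (w j * (h (j + 1))⁻¹) := by
            gcongr with j; exact h1 j
        _ = 2 * h n * (D * ∑ j ∈ Finset.range n, w j * (h (j + 1))⁻¹) := by
            rw [← Finset.mul_sum (Finset.range n) _ D]
        _ ≤ 2 * h n * (D * (2 * h n)) := by gcongr; exact hsum n
        _ = 4 * D * h n ^ 2 := by ring
        _ = _ := by rw [hsq]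
  have hfirst : IsNegligible P fun n ω => -(g n)⁻¹ • e n ω := by
    refine isNegligible_of_integral_le (fun n => (he2 n).const_smul _)
      (b := fun n => D * (g n)⁻¹) ?_ fun n => ?_
    · have := hg.tendsto_mul.const_mul D
      rw [mul_zero] at this
      refine this.congr fun n => by ring
    · simp only [norm_smul, mul_pow, Real.norm_eq_abs, sq_abs]
      rw [integral_const_mul]
      have hgn := hg.pos n
      calc (-(g n)⁻¹) ^ 2 * ∫ ω, ‖e n ω‖ ^ 2 ∂P ≤ (-(g n)⁻¹) ^ 2 * (D * g n) := by
            gcongr; exact hD n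
        _ = _ := by field_simp
  have hzero : IsNegligible P fun (_ : ℕ) ω => (g 0)⁻¹ • e 0 ω := by
    refine isNegligible_of_integral_le (fun n => (he2 0).const_smul _)
      (b := fun _ => ∫ ω, ‖(g 0)⁻¹ • e 0 ω‖ ^ 2 ∂P) ?_ fun n => le_rfl
    exact tendsto_inv_natCast_mul_const _
  have hall := (hfirst.add hzero).add hlast
  simpa only [habel] using hall

/-- The linearised sum of the iterates differs from the sum of the noises by a negligible term. -/
theorem isNegligible_apply_sum_sub (hM : HasLinearPart Q S L B A M) :
    IsNegligible P fun n ω =>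
      A (∑ j ∈ Finset.range n, e (j + 1) ω) - ∑ j ∈ Finset.range n, S (ζ j ω) 0 := by
  have hQ := he.isProbabilityMeasure
  have hL := hS.L_nonneg
  have he2 := he.memLp hS hg.pos
  have hdrift := he.isNegligible_sum hS hg (r := fun n x => meanDrift Q S (g n) x + A x)
    (by positivity : (0 : ℝ) ≤ 2 * L)
    (fun n => norm_meanDrift_add_sub_le hS hM (hg.pos n).le)
    (fun n => driftModulus_nonneg hS hM (hg.pos n).le)
    (fun i j hij => driftModulus_mono hS hM (hg.pos j).le (hg.antitone hij))
    (tendsto_driftModulus hS hM hg.pos hg.tendsto)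
    (fun n => norm_meanDrift_add_sub_le_local hS hM (hg.pos n).le)
  have hincr := he.isNegligible_sum_increments hS hg
  have hends : IsNegligible P fun n ω => A (e n ω - e 0 ω) := by
    obtain ⟨D, hD0, hD⟩ := he.exists_integral_norm_sq_le hS hg
    refine isNegligible_of_integral_le (fun n => A.comp_memLp' ((he2 n).sub (he2 0)))
      (b := fun _ => ‖A‖ ^ 2 * (2 * (D * g 0) + 2 * (D * g 0))) ?_ fun n => ?_
    · exact tendsto_inv_natCast_mul_const _
    · have h1 : ∫ ω, ‖A (e n ω - e 0 ω)‖ ^ 2 ∂P ≤ ‖A‖ ^ 2 * ∫ ω, ‖e n ω + -e 0 ω‖ ^ 2 ∂P := by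
        rw [← integral_const_mul]
        refine integral_mono ((A.comp_memLp' ((he2 n).sub (he2 0))).integrable_norm_pow two_ne_zero)
          ((((he2 n).add (he2 0).neg).integrable_norm_pow two_ne_zero).const_mul _) fun ω => ?_
        simp only
        rw [← mul_pow, ← sub_eq_add_neg]
        gcongr
        exact A.le_opNorm _
      refine h1.trans ?_
      have h2 := integral_norm_add_sq_le (he2 n) (he2 0).neg
      simp only [Pi.neg_apply, norm_neg] at h2
      have h3 : ∫ ω, ‖e n ω‖ ^ 2 ∂P ≤ D * g 0 :=
        (hD n).trans (by gcongr; exact hg.antitone (Nat.zero_le n))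
      gcongr
      linarith [hD 0]
  have hmart : IsNegligible P fun n ω => ∑ j ∈ Finset.range n,
      ((S (ζ j ω) (e (j + 1) ω) - S (ζ j ω) 0) - meanDrift Q S (g j) (e j ω)) := by
    have hG : ∀ j x, ∫ z, (S z (implicitStep S (g j) z x) - S z 0) ∂Q = meanDrift Q S (g j) x := by
      intro j x
      rw [integral_sub ((memLp_apply_implicitStep hS (hg.pos j).le x).integrable one_le_two)
        (hS.memLp.integrable one_le_two), hS.integral_eq_zero, sub_zero, meanDrift]
    have hmem : ∀ j, MemLp (fun ω => S (ζ j ω) (e (j + 1) ω) - S (ζ j ω) 0) 2 P := by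
      intro j
      refine ((he2 (j + 1)).norm.const_mul L).mono' ?_ (ae_of_all _ fun ω => ?_)
      · have h1 := (he.measurable hS hg.pos (j + 1)).mono (ℱ.le _) le_rfl
        have h2 := he.measurable_data' j
        exact ((hS.measurable.comp (h2.prodMk h1)).sub
          (hS.measurable.comp (h2.prodMk measurable_const))).aestronglyMeasurable
      · simpa using hS.lipschitz (ζ j ω) (e (j + 1) ω) 0
    have h := he.memLp_sum_increments hS hg.pos
      (G := fun j x z => S z (implicitStep S (g j) z x) - S z 0)
      (fun j => (hS.measurable.comp (measurable_snd.prodMk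
        (hS.measurable_implicitStep (hg.pos j).le))).sub
          (hS.measurable.comp (measurable_snd.prodMk measurable_const)))
      (fun j x => (memLp_apply_implicitStep hS (hg.pos j).le x).sub hS.memLp)
      (c := fun _ _ => 0) (fun _ => measurable_const)
      (fun j => by simpa only [← he.step j, sub_zero] using hmem j)
    simp only [← he.step, hG, sub_zero] at h
    refine isNegligible_of_integral_le (fun n => (h n).1)
      (b := fun n => ∑ j ∈ Finset.range n, L ^ 2 * ∫ ω, ‖e (j + 1) ω‖ ^ 2 ∂P) ?_ fun n =>
      (h n).2.trans (Finset.sum_le_sum fun j _ => ?_)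
    · have h1 : Tendsto (fun j => L ^ 2 * ∫ ω, ‖e (j + 1) ω‖ ^ 2 ∂P) atTop (𝓝 (L ^ 2 * 0)) :=
        ((he.tendsto_integral_norm_sq hS hg).comp (tendsto_add_atTop_nat 1)).const_mul _
      rw [mul_zero] at h1
      exact h1.cesaro
    · rw [← integral_const_mul]
      refine integral_mono ((hmem j).integrable_norm_pow two_ne_zero)
        (((he2 (j + 1)).integrable_norm_pow two_ne_zero).const_mul _) fun ω => ?_
      simp only
      rw [← mul_pow]
      gcongr
      simpa using hS.lipschitz (ζ j ω) (e (j + 1) ω) 0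
  have hall := ((hends.add hdrift).add hmart).add hincr
  refine Eq.mp (congrArg (IsNegligible P) ?_) hall
  ext1 n
  ext1 ω
  have hstep : ∀ j, (g j)⁻¹ • (e (j + 1) ω - e j ω) = S (ζ j ω) (e (j + 1) ω) := by
    intro j
    have h1 := hS.implicitStep_spec (hg.pos j).le (ζ j ω) (e j ω)
    rw [← he.step j ω] at h1
    have h2 : e (j + 1) ω - e j ω = g j • S (ζ j ω) (e (j + 1) ω) := by
      rw [sub_eq_iff_eq_add']; exact h1
    rw [h2, inv_smul_smul₀ (hg.pos j).ne']
  simp only [hstep, ← Finset.sum_range_sub fun j => e j ω, map_sum, map_sub, ← Finset.sum_neg_distrib,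
    ← Finset.sum_add_distrib, ← Finset.sum_sub_distrib]
  refine Finset.sum_congr rfl fun j _ => ?_
  abel

end IsImplicitProcess

end Negligible

/-! ### Limits of covariance matrices -/

section Covariance

variable {Ω : Type*} [MeasurableSpace Ω] {P : Measure Ω} [IsProbabilityMeasure P]

/-- The Cauchy-Schwarz inequality for covariances. -/
lemma covariance_sq_le {X Y : Ω → ℝ} (hX : MemLp X 2 P) (hY : MemLp Y 2 P) :
    covariance X Y P ^ 2 ≤ variance X P * variance Y P := by
  have h : ∀ x : ℝ, 0 ≤ variance X P * (x * x) + 2 * covariance X Y P * x + variance Y P := by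
    intro x
    have h1 : variance (x • X + Y) P
        = variance X P * (x * x) + 2 * covariance X Y P * x + variance Y P := by
      rw [variance_add (hX.const_smul x) hY, variance_smul, covariance_smul_left]
      ring
    rw [← h1]
    exact variance_nonneg _ _
  have h2 := discrim_le_zero h
  rw [discrim] at h2
  linarith

variable {p : ℕ}

omit [IsProbabilityMeasure P] in
lemma memLp_euclidean_apply {V : Ω → EuclideanSpace ℝ (Fin p)} (hV : MemLp V 2 P) (j : Fin p) :
    MemLp (fun ω => V ω j) 2 P :=
  (EuclideanSpace.proj (𝕜 := ℝ) j).comp_memLp' hV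

lemma variance_apply_le {V : Ω → EuclideanSpace ℝ (Fin p)} (hV : MemLp V 2 P)
    (c : EuclideanSpace ℝ (Fin p)) (j : Fin p) :
    variance (fun ω => V ω j) P ≤ ∫ ω, ‖V ω - c‖ ^ 2 ∂P := by
  have hVj := memLp_euclidean_apply hV j
  rw [← variance_sub_const hVj.1 (c j)]
  refine (variance_le_expectation_sq (hVj.sub (memLp_const _)).1).trans ?_
  refine integral_mono (hVj.sub (memLp_const _)).integrable_sq
    ((hV.sub (memLp_const c)).integrable_norm_pow two_ne_zero) fun ω => ?_
  have h := EuclideanSpace.norm_sq_eq (V ω - c)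
  have h1 := Finset.single_le_sum (f := fun i => ‖(V ω - c) i‖ ^ 2) (fun i _ => sq_nonneg _)
    (Finset.mem_univ j)
  simp only [Pi.pow_apply]
  rw [h]
  refine le_trans (le_of_eq ?_) h1
  simp

/-- The covariance matrices of sums of `n` terms, divided by `n`, do not change in the limit if a
negligible term is added. -/
lemma tendsto_varianceMatrix_of_isNegligible {X V : ℕ → Ω → EuclideanSpace ℝ (Fin p)}
    {A : Matrix (Fin p) (Fin p) ℝ} (hX : ∀ n, MemLp (X n) 2 P)
    (hXA : ∀ n, varianceMatrix P (X n) = (n : ℝ) • A)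
    (hV : IsNegligible P fun n ω => V n ω - X n ω) :
    Tendsto (fun n : ℕ => (n : ℝ)⁻¹ • varianceMatrix P (V n)) atTop (𝓝 A) := by
  set R : ℕ → Ω → EuclideanSpace ℝ (Fin p) := fun n ω => V n ω - X n ω with hR
  obtain ⟨hR2, c, hc⟩ := hV
  have hRj := fun n j => memLp_euclidean_apply (hR2 n) j
  have hXj := fun n j => memLp_euclidean_apply (hX n) j
  have hvarR : ∀ j, Tendsto (fun n : ℕ => (n : ℝ)⁻¹ * variance (fun ω => R n ω j) P) atTop
      (𝓝 0) := fun j =>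
    squeeze_zero (fun n => mul_nonneg (by positivity) (variance_nonneg _ _))
      (fun n => mul_le_mul_of_nonneg_left (variance_apply_le (hR2 n) (c n) j) (by positivity)) hc
  have hcovX : ∀ n j k, covariance (fun ω => X n ω j) (fun ω => X n ω k) P = n * A j k := by
    intro n j k
    have h := congrFun (congrFun (hXA n) j) k
    simpa [varianceMatrix] using h
  have hvarX : ∀ n j, variance (fun ω => X n ω j) P = n * A j j := by
    intro n j
    rw [← covariance_self (hXj n j).1.aemeasurable, hcovX]
  have hcross : ∀ (U T : ℕ → Ω → ℝ) (D : ℝ), (∀ n, MemLp (U n) 2 P) → (∀ n, MemLp (T n) 2 P) →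
      (∀ n : ℕ, (n : ℝ)⁻¹ * variance (U n) P ≤ D) →
      Tendsto (fun n : ℕ => (n : ℝ)⁻¹ * variance (T n) P) atTop (𝓝 0) →
      Tendsto (fun n : ℕ => (n : ℝ)⁻¹ * covariance (U n) (T n) P) atTop (𝓝 0) := by
    intro U T D hU hT hD hT0
    have hsq : Tendsto (fun n : ℕ => ((n : ℝ)⁻¹ * covariance (U n) (T n) P) ^ 2) atTop (𝓝 0) := by
      have h0 := hT0.const_mul D
      rw [mul_zero] at h0
      refine squeeze_zero (fun n => sq_nonneg _) (fun n => ?_) h0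
      calc ((n : ℝ)⁻¹ * covariance (U n) (T n) P) ^ 2
          = (n : ℝ)⁻¹ ^ 2 * covariance (U n) (T n) P ^ 2 := mul_pow _ _ _
        _ ≤ (n : ℝ)⁻¹ ^ 2 * (variance (U n) P * variance (T n) P) := by
          gcongr; exact covariance_sq_le (hU n) (hT n)
        _ = ((n : ℝ)⁻¹ * variance (U n) P) * ((n : ℝ)⁻¹ * variance (T n) P) := by ring
        _ ≤ _ := mul_le_mul_of_nonneg_right (hD n)
          (mul_nonneg (by positivity) (variance_nonneg _ _))
    have h1 := (Real.continuous_sqrt.tendsto 0).comp hsq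
    rw [Real.sqrt_zero] at h1
    refine (tendsto_zero_iff_abs_tendsto_zero _).2 (h1.congr fun n => ?_)
    simp [Real.sqrt_sq_eq_abs]
  have hbX : ∀ j, ∀ n : ℕ, (n : ℝ)⁻¹ * variance (fun ω => X n ω j) P ≤ |A j j| := by
    intro j n
    rw [hvarX]
    rcases eq_or_ne (n : ℝ) 0 with h | h
    · rw [h]; simp
    · rw [inv_mul_cancel_left₀ h]; exact le_abs_self _
  have hbR : ∀ j, ∃ D, ∀ n : ℕ, (n : ℝ)⁻¹ * variance (fun ω => R n ω j) P ≤ D := by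
    intro j
    obtain ⟨D, hD⟩ := (hvarR j).bddAbove_range
    exact ⟨D, fun n => hD ⟨n, rfl⟩⟩
  refine tendsto_pi_nhds.2 fun j => tendsto_pi_nhds.2 fun k => ?_
  have h1 := hcross (fun n ω => X n ω j) (fun n ω => R n ω k) _ (fun n => hXj n j)
    (fun n => hRj n k) (hbX j) (hvarR k)
  have h2 := hcross (fun n ω => X n ω k) (fun n ω => R n ω j) _ (fun n => hXj n k)
    (fun n => hRj n j) (hbX k) (hvarR j)
  have h3 := hcross (fun n ω => R n ω j) (fun n ω => R n ω k) _ (fun n => hRj n j)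
    (fun n => hRj n k) (hbR j).choose_spec (hvarR k)
  have hsum := ((tendsto_const_nhds (x := A j k)).add h1).add (h2.add h3)
  simp only [add_zero] at hsum
  refine hsum.congr' ?_
  filter_upwards [eventually_ge_atTop 1] with n hn
  have hn0 : (n : ℝ) ≠ 0 := by positivity
  have hVX : ∀ i, (fun ω => V n ω i) = (fun ω => X n ω i) + fun ω => R n ω i := by
    intro i; ext ω; simp [hR]
  simp only [varianceMatrix, Matrix.smul_apply, Matrix.of_apply, smul_eq_mul]
  rw [hVX j, hVX k, covariance_add_left (hXj n j) (hRj n j) ((hXj n k).add (hRj n k)),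
    covariance_add_right (hXj n j) (hXj n k) (hRj n k),
    covariance_add_right (hRj n j) (hXj n k) (hRj n k), hcovX,
    covariance_comm (fun ω => R n ω j) (fun ω => X n ω k)]
  field_simp

lemma varianceMatrix_toEuclideanLin {V : Ω → EuclideanSpace ℝ (Fin p)} (hV : MemLp V 2 P)
    (A : Matrix (Fin p) (Fin p) ℝ) :
    varianceMatrix P (fun ω => Matrix.toEuclideanLin A (V ω))
      = A * varianceMatrix P V * A.transpose := by
  have hVj := fun j => memLp_euclidean_apply hV j
  ext j k
  have h : ∀ i, (fun ω => (Matrix.toEuclideanLin A (V ω)) i)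
      = fun ω => ∑ l, A i l * V ω l := by
    intro i; ext ω
    simp [Matrix.toLpLin_apply, Matrix.mulVec, dotProduct]
  simp only [varianceMatrix, Matrix.of_apply, Matrix.mul_apply, Matrix.transpose_apply]
  rw [h, h, covariance_fun_sum_fun_sum (fun i => (hVj i).const_mul _)
    (fun i => (hVj i).const_mul _), Finset.sum_comm]
  refine Finset.sum_congr rfl fun l _ => ?_
  rw [Finset.sum_mul]
  refine Finset.sum_congr rfl fun i _ => ?_
  rw [covariance_const_mul_left, covariance_const_mul_right]
  ring

lemma varianceMatrix_sum {N : ℕ → Ω → EuclideanSpace ℝ (Fin p)} (hN : ∀ j, MemLp (N j) 2 P)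
    (hindep : Pairwise fun i j => IndepFun (N i) (N j) P) {A : Matrix (Fin p) (Fin p) ℝ}
    (hA : ∀ j, varianceMatrix P (N j) = A) (n : ℕ) :
    varianceMatrix P (fun ω => ∑ j ∈ Finset.range n, N j ω) = (n : ℝ) • A := by
  have hNj := fun i j => memLp_euclidean_apply (hN i) j
  ext a b
  have h : ∀ i, (fun ω => (∑ j ∈ Finset.range n, N j ω) i)
      = fun ω => ∑ j ∈ Finset.range n, N j ω i := by
    intro i; ext ω
    simp
  simp only [varianceMatrix, Matrix.of_apply, Matrix.smul_apply, smul_eq_mul]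
  rw [h, h, covariance_fun_sum_fun_sum' (fun i _ => hNj i a) (fun i _ => hNj i b)]
  have hdiag : ∀ i ∈ Finset.range n, ∑ j ∈ Finset.range n,
      covariance (fun ω => N i ω a) (fun ω => N j ω b) P = A a b := by
    intro i hi
    rw [Finset.sum_eq_single_of_mem i hi]
    · exact congrFun (congrFun (hA i) a) b
    · intro j _ hji
      have hm : ∀ c : Fin p, Measurable fun x : EuclideanSpace ℝ (Fin p) => x c := fun c =>
        (EuclideanSpace.proj (𝕜 := ℝ) c).measurable
      exact ((hindep hji.symm).comp (hm a) (hm b)).covariance_eq_zero (hNj i a) (hNj j b)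
  rw [Finset.sum_congr rfl hdiag]
  simp

/-- If `A W` is asymptotically a sum of `n` independent terms with covariance matrix `A`, then the
covariance matrix of `W`, divided by `n`, tends to the inverse of `A`. -/
lemma tendsto_varianceMatrix_inv {N W : ℕ → Ω → EuclideanSpace ℝ (Fin p)}
    (hN : ∀ j, MemLp (N j) 2 P) (hindep : Pairwise fun i j => IndepFun (N i) (N j) P)
    {A : Matrix (Fin p) (Fin p) ℝ} (hA : ∀ j, varianceMatrix P (N j) = A) (hAunit : IsUnit A)
    (hAsymm : A.transpose = A) (hW : ∀ n, MemLp (W n) 2 P)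
    (hneg : IsNegligible P fun n ω =>
      Matrix.toEuclideanLin A (W n ω) - ∑ j ∈ Finset.range n, N j ω) :
    Tendsto (fun n : ℕ => (n : ℝ)⁻¹ • varianceMatrix P (W n)) atTop (𝓝 A⁻¹) := by
  have h := tendsto_varianceMatrix_of_isNegligible
    (X := fun n ω => ∑ j ∈ Finset.range n, N j ω)
    (fun n => memLp_finsetSum _ fun j _ => hN j) (varianceMatrix_sum hN hindep hA) hneg
  have hdet : IsUnit A.det := (Matrix.isUnit_iff_isUnit_det A).1 hAunit
  have hcont : Continuous fun B : Matrix (Fin p) (Fin p) ℝ => A⁻¹ * B * A⁻¹ := by fun_prop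
  have h2 := (hcont.tendsto A).comp h
  rw [Matrix.nonsing_inv_mul A hdet, one_mul] at h2
  refine h2.congr fun n => ?_
  simp only [Function.comp_apply]
  rw [varianceMatrix_toEuclideanLin (hW n), hAsymm, Matrix.mul_smul, Matrix.smul_mul,
    Matrix.mul_assoc A, Matrix.nonsing_inv_mul_cancel_left _ _ hdet,
    Matrix.mul_nonsing_inv_cancel_right _ _ hdet]

end Covariance

/-! ### Filtration of the data and properties of the score -/

section Filtration

variable {Ω E Z : Type*} {m0 : MeasurableSpace Ω} [MeasurableSpace E] [MeasurableSpace Z]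
  {P : Measure Ω}

lemma indepFun_prodMk_left_of_indepFun [IsFiniteMeasure P] {α β δ : Type*} [MeasurableSpace α]
    [MeasurableSpace β] [MeasurableSpace δ] {U : Ω → α} {V : Ω → β} {W : Ω → δ}
    (hU : Measurable U) (hV : Measurable V) (hW : Measurable W)
    (h1 : IndepFun U (fun ω => (V ω, W ω)) P) (h2 : IndepFun V W P) :
    IndepFun (fun ω => (U ω, V ω)) W P := by
  have h3 : IndepFun U V P := h1.comp measurable_id measurable_fst
  rw [indepFun_iff_map_prod_eq_prod_map_map (hU.prodMk hV).aemeasurable hW.aemeasurable,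
    (indepFun_iff_map_prod_eq_prod_map_map hU.aemeasurable hV.aemeasurable).1 h3]
  have h4 := (indepFun_iff_map_prod_eq_prod_map_map hU.aemeasurable
    (hV.prodMk hW).aemeasurable).1 h1
  rw [(indepFun_iff_map_prod_eq_prod_map_map hV.aemeasurable hW.aemeasurable).1 h2,
    ← Measure.prodAssoc_prod] at h4
  have h5 := congrArg (Measure.map MeasurableEquiv.prodAssoc.symm) h4
  rw [Measure.map_map MeasurableEquiv.prodAssoc.symm.measurable
    MeasurableEquiv.prodAssoc.measurable, Measure.map_map
    MeasurableEquiv.prodAssoc.symm.measurable (hU.prodMk (hV.prodMk hW))] at h5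
  simpa [Function.comp_def, MeasurableEquiv.prodAssoc] using h5

/-- The filtration generated by an initial value `U` and the data `ζ 0, ζ 1, …`; at time `n` the
data with indices below `n` are known. -/
def dataFiltration (U : Ω → E) (ζ : ℕ → Ω → Z) (hU : Measurable U) (hζ : ∀ n, Measurable (ζ n)) :
    Filtration ℕ m0 where
  seq n := MeasurableSpace.comap (fun ω => (U ω, fun i : Finset.range n => ζ i ω)) inferInstance
  mono' i j hij := by
    have hsub : Finset.range i ⊆ Finset.range j := Finset.range_subset_range.2 hij
    have h : Measurable fun q : E × (Finset.range j → Z) =>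
        (q.1, fun k : Finset.range i => q.2 ⟨k, hsub k.2⟩) :=
      measurable_fst.prodMk (measurable_pi_lambda _ fun k =>
        (measurable_pi_apply _).comp measurable_snd)
    exact (h.comp (comap_measurable fun ω => (U ω, fun i : Finset.range j => ζ i ω))).comap_le
  le' n := (hU.prodMk (measurable_pi_lambda _ fun i : Finset.range n => hζ i)).comap_le

variable {U : Ω → E} {ζ : ℕ → Ω → Z} (hU : Measurable U) (hζ : ∀ n, Measurable (ζ n))

lemma measurable_initial_dataFiltration : Measurable[dataFiltration U ζ hU hζ 0] U :=
  measurable_fst.comp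
    (comap_measurable fun ω => (U ω, fun i : Finset.range 0 => ζ i ω))

lemma measurable_dataFiltration (n : ℕ) : Measurable[dataFiltration U ζ hU hζ (n + 1)] (ζ n) :=
  ((measurable_pi_apply (⟨n, Finset.self_mem_range_succ n⟩ : Finset.range (n + 1))).comp
    measurable_snd).comp (comap_measurable fun ω => (U ω, fun i : Finset.range (n + 1) => ζ i ω))

lemma indep_dataFiltration [IsFiniteMeasure P] (hind : iIndepFun ζ P)
    (hUind : IndepFun U (fun ω n => ζ n ω) P) (n : ℕ) :
    Indep (dataFiltration U ζ hU hζ n) (MeasurableSpace.comap (ζ n) inferInstance) P := by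
  have hpast : Measurable fun ω => fun i : Finset.range n => ζ i ω :=
    measurable_pi_lambda _ fun i => hζ i
  have h1 : IndepFun U (fun ω => ((fun i : Finset.range n => ζ i ω), ζ n ω)) P := by
    have hm : Measurable fun q : ℕ → Z => ((fun i : Finset.range n => q i), q n) :=
      (measurable_pi_lambda _ fun i => measurable_pi_apply _).prodMk (measurable_pi_apply _)
    exact hUind.comp measurable_id hm
  have h2 : IndepFun (fun ω => fun i : Finset.range n => ζ i ω) (ζ n) P := by
    have h := hind.indepFun_finset (Finset.range n) {n} (by simp) hζ
    exact h.comp measurable_id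
      (measurable_pi_apply (⟨n, Finset.mem_singleton_self n⟩ : ({n} : Finset ℕ)))
  exact (IndepFun_iff_Indep _ _ _).1 (indepFun_prodMk_left_of_indepFun hU hpast (hζ n) h1 h2)

end Filtration

section VectorField

variable {E : Type*} [NormedAddCommGroup E] [InnerProductSpace ℝ E]

lemma inner_sub_le_of_fderiv {s : E → E} (hs : Differentiable ℝ s) {lam : ℝ}
    (h : ∀ x v, inner ℝ (fderiv ℝ s x v) v ≤ -lam * ‖v‖ ^ 2) (a b : E) :
    inner ℝ (s a - s b) (a - b) ≤ -lam * ‖a - b‖ ^ 2 := by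
  have hd : ∀ t : ℝ, HasDerivAt (fun t : ℝ => inner ℝ (s (b + t • (a - b))) (a - b))
      (inner ℝ (fderiv ℝ s (b + t • (a - b)) (a - b)) (a - b)) t := by
    intro t
    have h1 : HasDerivAt (fun t : ℝ => b + t • (a - b)) (a - b) t := by
      simpa using ((hasDerivAt_id t).smul_const (a - b)).const_add b
    have h2 := (hs (b + t • (a - b))).hasFDerivAt.comp_hasDerivAt t h1
    simpa using h2.inner ℝ (hasDerivAt_const t (a - b))
  have h3 := image_sub_le_mul_sub_of_deriv_le (fun t => (hd t).differentiableAt)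
    (fun t => (hd t).deriv.trans_le (h _ _)) (zero_le_one)
  simpa [inner_sub_left] using h3

/-- The second order remainder of a Lipschitz field at `x₀`: by the mean value inequality, applied
twice, if the points are in the ball on which the second derivative is bounded, and by the Lipschitz
property otherwise. -/
lemma norm_sub_sub_fderiv_le {s : E → E} (hs : Differentiable ℝ s) {L : ℝ≥0}
    (hL : LipschitzWith L s) {x₀ : E} {δ M : ℝ} (hδ : 0 < δ)
    (hM : ∀ x ∈ Metric.ball x₀ δ, DifferentiableAt ℝ (fderiv ℝ s) x ∧
      ‖fderiv ℝ (fderiv ℝ s) x‖ ≤ M) (a b : E) :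
    ‖s (x₀ + a) - s (x₀ + b) - fderiv ℝ s x₀ (a - b)‖
      ≤ (|M| + 2 * L / δ) * max ‖a‖ ‖b‖ * ‖a - b‖ := by
  have hm0 : 0 ≤ max ‖a‖ ‖b‖ := (norm_nonneg a).trans (le_max_left _ _)
  have hL0 : 0 ≤ 2 * (L : ℝ) / δ := by positivity
  rcases lt_or_ge (max ‖a‖ ‖b‖) δ with hlt | hge
  · have hball : ∀ x ∈ Metric.closedBall x₀ (max ‖a‖ ‖b‖), x ∈ Metric.ball x₀ δ := fun x hx =>
      Metric.closedBall_subset_ball hlt hx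
    have hderiv : ∀ x ∈ Metric.closedBall x₀ (max ‖a‖ ‖b‖),
        ‖fderiv ℝ s x - fderiv ℝ s x₀‖ ≤ |M| * max ‖a‖ ‖b‖ := by
      intro x hx
      have h1 := (convex_ball x₀ δ).norm_image_sub_le_of_norm_fderiv_le (𝕜 := ℝ)
        (fun y hy => (hM y hy).1) (fun y hy => (hM y hy).2.trans (le_abs_self M))
        (Metric.mem_ball_self hδ) (hball x hx)
      refine h1.trans ?_
      gcongr
      rw [← dist_eq_norm]
      exact hx
    have hF : ∀ x ∈ Metric.closedBall x₀ (max ‖a‖ ‖b‖),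
        HasFDerivWithinAt (fun x => s x - fderiv ℝ s x₀ x) (fderiv ℝ s x - fderiv ℝ s x₀)
          (Metric.closedBall x₀ (max ‖a‖ ‖b‖)) x := fun x _ =>
      ((hs x).hasFDerivAt.sub (fderiv ℝ s x₀).hasFDerivAt).hasFDerivWithinAt
    have h2 := (convex_closedBall x₀ (max ‖a‖ ‖b‖)).norm_image_sub_le_of_norm_hasFDerivWithin_le
      hF hderiv (x := x₀ + b) (y := x₀ + a) (by simp) (by simp)
    have h3 : s (x₀ + a) - s (x₀ + b) - fderiv ℝ s x₀ (a - b)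
        = s (x₀ + a) - fderiv ℝ s x₀ (x₀ + a) - (s (x₀ + b) - fderiv ℝ s x₀ (x₀ + b)) := by
      simp only [map_sub, map_add]; abel
    rw [h3]
    refine h2.trans ?_
    rw [add_sub_add_left_eq_sub]
    gcongr
    linarith
  · have h1 : ‖s (x₀ + a) - s (x₀ + b)‖ ≤ L * ‖a - b‖ := by
      simpa using hL.norm_sub_le (x₀ + a) (x₀ + b)
    have h2 : ‖fderiv ℝ s x₀ (a - b)‖ ≤ L * ‖a - b‖ :=
      ((fderiv ℝ s x₀).le_opNorm _).trans
        (by gcongr; exact norm_fderiv_le_of_lipschitz ℝ hL)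
    have h3 : 2 * (L : ℝ) ≤ (|M| + 2 * L / δ) * max ‖a‖ ‖b‖ := by
      calc 2 * (L : ℝ) = 2 * L / δ * δ := by field_simp
        _ ≤ (|M| + 2 * L / δ) * max ‖a‖ ‖b‖ := by
          gcongr
          linarith [abs_nonneg M]
    calc _ ≤ ‖s (x₀ + a) - s (x₀ + b)‖ + ‖fderiv ℝ s x₀ (a - b)‖ := norm_sub_le _ _
      _ ≤ 2 * L * ‖a - b‖ := by linarith
      _ ≤ _ := by gcongr

end VectorField

section Score

variable {p d : ℕ}
  {f : EuclideanSpace ℝ (Fin d) → EuclideanSpace ℝ (Fin p) → EuclideanSpace ℝ (Fin p) → ℝ}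

lemma euclidean_sum_single (x : EuclideanSpace ℝ (Fin p)) :
    ∑ k, x k • EuclideanSpace.single k (1 : ℝ) = x := by
  simpa using (EuclideanSpace.basisFun (Fin p) ℝ).sum_repr x

lemma toEuclideanLin_observedInfo
    (z : EuclideanSpace ℝ (Fin p) × EuclideanSpace ℝ (Fin d)) (θ x : EuclideanSpace ℝ (Fin p)) :
    Matrix.toEuclideanLin (observedInfo f z θ) x = -fderiv ℝ (score f z) θ x := by
  ext j
  conv_rhs => rw [← euclidean_sum_single x, map_sum]
  simp [Matrix.toLpLin_apply, Matrix.mulVec, dotProduct, observedInfo, mul_comm]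

lemma inner_fderiv_score_le {z : EuclideanSpace ℝ (Fin p) × EuclideanSpace ℝ (Fin d)}
    {θ : EuclideanSpace ℝ (Fin p)} {lam : ℝ}
    (h : (observedInfo f z θ - lam • (1 : Matrix (Fin p) (Fin p) ℝ)).PosSemidef)
    (v : EuclideanSpace ℝ (Fin p)) :
    inner ℝ (fderiv ℝ (score f z) θ v) v ≤ -lam * ‖v‖ ^ 2 := by
  have h1 := h.dotProduct_mulVec_nonneg (WithLp.ofLp v)
  have h2 : inner ℝ (Matrix.toEuclideanLin (observedInfo f z θ) v) v
      = star (WithLp.ofLp v) ⬝ᵥ (observedInfo f z θ).mulVec (WithLp.ofLp v) := by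
    rw [EuclideanSpace.inner_eq_star_dotProduct]
    simp [Matrix.toLpLin_apply]
  have h3 : ‖v‖ ^ 2 = star (WithLp.ofLp v) ⬝ᵥ WithLp.ofLp v := by
    rw [← real_inner_self_eq_norm_sq, EuclideanSpace.inner_eq_star_dotProduct]
    simp
  rw [toEuclideanLin_observedInfo, inner_neg_left] at h2
  rw [Matrix.sub_mulVec, dotProduct_sub, Matrix.smul_mulVec, Matrix.one_mulVec, dotProduct_smul,
    ← h2, ← h3, smul_eq_mul] at h1
  linarith

/-- The score is a limit of difference quotients of the log-likelihood. -/
lemma tendsto_score {z : EuclideanSpace ℝ (Fin p) × EuclideanSpace ℝ (Fin d)}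
    (h : Differentiable ℝ (logLik f z)) (θ : EuclideanSpace ℝ (Fin p)) :
    Tendsto (fun n : ℕ => ∑ k, ((n : ℝ) * (logLik f z (θ + (n : ℝ)⁻¹ • EuclideanSpace.single k 1)
      - logLik f z θ)) • EuclideanSpace.single k (1 : ℝ)) atTop (𝓝 (score f z θ)) := by
  have h1 : score f z θ = ∑ k, fderiv ℝ (logLik f z) θ (EuclideanSpace.single k 1) •
      EuclideanSpace.single k (1 : ℝ) := by
    rw [← euclidean_sum_single (score f z θ)]
    refine Finset.sum_congr rfl fun k _ => ?_
    congr 1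
    rw [← InnerProductSpace.toDual_symm_apply (𝕜 := ℝ), ← gradient, ← score,
      EuclideanSpace.inner_single_right]
    simp
  rw [h1]
  refine tendsto_finsetSum _ fun k _ => Tendsto.smul_const ?_ _
  exact ((h θ).hasFDerivAt.lim_real (EuclideanSpace.single k 1)).comp tendsto_natCast_atTop_atTop

end Score

/-! ### The centred score -/

section CentredScore

variable {p d : ℕ}
  {f : EuclideanSpace ℝ (Fin d) → EuclideanSpace ℝ (Fin p) → EuclideanSpace ℝ (Fin p) → ℝ}
  {θs : EuclideanSpace ℝ (Fin p)}

/-- A measurable set `G` of data points at which the assumptions on the log-likelihood that hold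
almost surely are true; the third derivative is bounded on a ball around `θs`. -/
structure IsRegularSet
    (f : EuclideanSpace ℝ (Fin d) → EuclideanSpace ℝ (Fin p) → EuclideanSpace ℝ (Fin p) → ℝ)
    (θs : EuclideanSpace ℝ (Fin p)) (L₀ : ℝ≥0) (lam δ : ℝ)
    (M : EuclideanSpace ℝ (Fin p) × EuclideanSpace ℝ (Fin d) → ℝ)
    (G : Set (EuclideanSpace ℝ (Fin p) × EuclideanSpace ℝ (Fin d))) : Prop where
  measurableSet : MeasurableSet G
  differentiable : ∀ z ∈ G, Differentiable ℝ (logLik f z)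
  differentiable_score : ∀ z ∈ G, Differentiable ℝ (score f z)
  lipschitz_score : ∀ z ∈ G, LipschitzWith L₀ (score f z)
  posSemidef : ∀ z ∈ G, ∀ θ,
    (observedInfo f z θ - lam • (1 : Matrix (Fin p) (Fin p) ℝ)).PosSemidef
  third_derivative : ∀ z ∈ G, ∀ θ ∈ Metric.ball θs δ,
    DifferentiableAt ℝ (fderiv ℝ (score f z)) θ ∧ ‖fderiv ℝ (fderiv ℝ (score f z)) θ‖ ≤ M z

open Classical in
/-- The score as a function of the distance to `θs`.  Off the set `G` of regular data points it is
replaced by a linear field, so that its properties hold everywhere. -/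
noncomputable def centredScore
    (f : EuclideanSpace ℝ (Fin d) → EuclideanSpace ℝ (Fin p) → EuclideanSpace ℝ (Fin p) → ℝ)
    (θs : EuclideanSpace ℝ (Fin p)) (lam : ℝ)
    (G : Set (EuclideanSpace ℝ (Fin p) × EuclideanSpace ℝ (Fin d)))
    (z : EuclideanSpace ℝ (Fin p) × EuclideanSpace ℝ (Fin d)) (x : EuclideanSpace ℝ (Fin p)) :
    EuclideanSpace ℝ (Fin p) :=
  if z ∈ G then score f z (θs + x) else -lam • x

open Classical in
/-- Minus the derivative at the origin of `centredScore`. -/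
noncomputable def centredInfo
    (f : EuclideanSpace ℝ (Fin d) → EuclideanSpace ℝ (Fin p) → EuclideanSpace ℝ (Fin p) → ℝ)
    (θs : EuclideanSpace ℝ (Fin p)) (lam : ℝ)
    (G : Set (EuclideanSpace ℝ (Fin p) × EuclideanSpace ℝ (Fin d)))
    (z : EuclideanSpace ℝ (Fin p) × EuclideanSpace ℝ (Fin d)) :
    EuclideanSpace ℝ (Fin p) →L[ℝ] EuclideanSpace ℝ (Fin p) :=
  if z ∈ G then -fderiv ℝ (score f z) θs else lam • ContinuousLinearMap.id ℝ _

variable {L₀ : ℝ≥0} {lam δ : ℝ} {M : EuclideanSpace ℝ (Fin p) × EuclideanSpace ℝ (Fin d) → ℝ}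
  {G : Set (EuclideanSpace ℝ (Fin p) × EuclideanSpace ℝ (Fin d))}
  {Q : Measure (EuclideanSpace ℝ (Fin p) × EuclideanSpace ℝ (Fin d))}

lemma measurable_centredScore
    (hf : Measurable fun q : (EuclideanSpace ℝ (Fin p) × EuclideanSpace ℝ (Fin d)) ×
      EuclideanSpace ℝ (Fin p) => f q.1.2 q.1.1 q.2)
    (hG : IsRegularSet f θs L₀ lam δ M G) :
    Measurable fun q : (EuclideanSpace ℝ (Fin p) × EuclideanSpace ℝ (Fin d)) ×
      EuclideanSpace ℝ (Fin p) => centredScore f θs lam G q.1 q.2 := by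
  classical
  have hlog : Measurable fun q : (EuclideanSpace ℝ (Fin p) × EuclideanSpace ℝ (Fin d)) ×
      EuclideanSpace ℝ (Fin p) => logLik f q.1 q.2 := Real.measurable_log.comp hf
  refine measurable_of_tendsto_metrizable (f := fun (n : ℕ) q => if q.1 ∈ G then
    ∑ k, ((n : ℝ) * (logLik f q.1 (θs + q.2 + (n : ℝ)⁻¹ • EuclideanSpace.single k 1)
      - logLik f q.1 (θs + q.2))) • EuclideanSpace.single k (1 : ℝ) else -lam • q.2)
    (fun n => ?_) (tendsto_pi_nhds.2 fun q => ?_)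
  · have h0 : Measurable fun q : (EuclideanSpace ℝ (Fin p) × EuclideanSpace ℝ (Fin d)) ×
        EuclideanSpace ℝ (Fin p) => -lam • q.2 := measurable_snd.const_smul (-lam)
    refine Measurable.ite (measurable_fst hG.measurableSet) ?_ h0
    refine Finset.measurable_fun_sum _ fun k _ => Measurable.smul_const ?_ _
    have h1 := hlog.comp (measurable_fst.prodMk (measurable_snd.const_add θs))
    have h2 := hlog.comp (measurable_fst.prodMk ((measurable_snd.const_add θs).add_const
      ((n : ℝ)⁻¹ • EuclideanSpace.single k (1 : ℝ))))
    exact (h2.sub h1).const_mul _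
  · by_cases hq : q.1 ∈ G
    · simp only [centredScore, if_pos hq]
      exact tendsto_score (hG.differentiable _ hq) _
    · simp only [centredScore, if_neg hq]
      exact tendsto_const_nhds

lemma centredScore_ae_eq (hGQ : ∀ᵐ z ∂Q, z ∈ G) :
    (fun z => centredScore f θs lam G z 0) =ᵐ[Q] fun z => score f z θs := by
  filter_upwards [hGQ] with z hz
  simp [centredScore, hz]

lemma isMonotoneField_centredScore (hlam : 0 < lam)
    (hf : Measurable fun q : (EuclideanSpace ℝ (Fin p) × EuclideanSpace ℝ (Fin d)) ×
      EuclideanSpace ℝ (Fin p) => f q.1.2 q.1.1 q.2)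
    (hG : IsRegularSet f θs L₀ lam δ M G) (hGQ : ∀ᵐ z ∂Q, z ∈ G)
    (hmem : MemLp (fun z => score f z θs) 2 Q) (hzero : ∫ z, score f z θs ∂Q = 0) :
    IsMonotoneField Q (centredScore f θs lam G) lam (max L₀ lam) where
  lam_pos := hlam
  L_nonneg := hlam.le.trans (le_max_right _ _)
  measurable := measurable_centredScore hf hG
  lipschitz z a b := by
    by_cases hz : z ∈ G
    · simp only [centredScore, if_pos hz]
      refine ((hG.lipschitz_score z hz).norm_sub_le _ _).trans ?_
      rw [add_sub_add_left_eq_sub]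
      gcongr
      exact le_max_left _ _
    · simp only [centredScore, if_neg hz, ← smul_sub, norm_smul, norm_neg,
        Real.norm_of_nonneg hlam.le]
      gcongr
      exact le_max_right _ _
  monotone z a b := by
    by_cases hz : z ∈ G
    · simp only [centredScore, if_pos hz]
      have h := inner_sub_le_of_fderiv (hG.differentiable_score z hz)
        (fun x v => inner_fderiv_score_le (hG.posSemidef z hz x) v) (θs + a) (θs + b)
      rwa [add_sub_add_left_eq_sub] at h
    · simp only [centredScore, if_neg hz, ← smul_sub]
      rw [inner_smul_left, real_inner_self_eq_norm_sq]
      simp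
  memLp := hmem.ae_eq (centredScore_ae_eq hGQ).symm
  integral_eq_zero := (integral_congr_ae (centredScore_ae_eq hGQ)).trans hzero

lemma hasLinearPart_centredScore [IsProbabilityMeasure Q] (hlam : 0 < lam) (hδ : 0 < δ)
    (hG : IsRegularSet f θs L₀ lam δ M G) (hGQ : ∀ᵐ z ∂Q, z ∈ G) (hM : Integrable M Q)
    {A : Matrix (Fin p) (Fin p) ℝ} (hint : ∀ j k, Integrable (fun z => observedInfo f z θs j k) Q)
    (hA : ∀ j k, ∫ z, observedInfo f z θs j k ∂Q = A j k) :
    HasLinearPart Q (centredScore f θs lam G) (max L₀ lam) (centredInfo f θs lam G)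
      (Matrix.toEuclideanLin A).toContinuousLinearMap fun z => |M z| + 2 * L₀ / δ := by
  have hlin : ∀ (A : Matrix (Fin p) (Fin p) ℝ) (x : EuclideanSpace ℝ (Fin p)),
      Matrix.toEuclideanLin A x = ∑ j, (∑ k, A j k * x k) • EuclideanSpace.single j (1 : ℝ) := by
    intro A x
    rw [← euclidean_sum_single (Matrix.toEuclideanLin A x)]
    refine Finset.sum_congr rfl fun j _ => ?_
    simp [Matrix.toLpLin_apply, Matrix.mulVec, dotProduct]
  have hae : ∀ x, (fun z => ∑ j, (∑ k, observedInfo f z θs j k * x k) •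
      EuclideanSpace.single j (1 : ℝ)) =ᵐ[Q] fun z => centredInfo f θs lam G z x := by
    intro x
    filter_upwards [hGQ] with z hz
    rw [← hlin, toEuclideanLin_observedInfo]
    simp [centredInfo, hz]
  have hi : ∀ x : EuclideanSpace ℝ (Fin p), ∀ j,
      Integrable (fun z => ∑ k, observedInfo f z θs j k * x k) Q := fun x j =>
    integrable_finsetSum _ fun k _ => (hint j k).mul_const _
  refine ⟨fun z => ?_, fun x => ?_, fun x => ?_, ?_, fun z => ?_, fun z a b => ?_⟩
  · by_cases hz : z ∈ G
    · simp only [centredInfo, if_pos hz, norm_neg]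
      exact (norm_fderiv_le_of_lipschitz ℝ (hG.lipschitz_score z hz)).trans (le_max_left _ _)
    · simp only [centredInfo, if_neg hz]
      refine ContinuousLinearMap.opNorm_le_bound _ (hlam.le.trans (le_max_right _ _)) fun x => ?_
      simp only [smul_apply, ContinuousLinearMap.id_apply, norm_smul,
        Real.norm_of_nonneg hlam.le]
      gcongr
      exact le_max_right _ _
  · exact (integrable_finsetSum _ fun j _ => (hi x j).smul_const _).congr (hae x)
  · rw [← integral_congr_ae (hae x), integral_finsetSum _ fun j _ => (hi x j).smul_const _]
    simp only [LinearMap.coe_toContinuousLinearMap']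
    rw [hlin]
    refine Finset.sum_congr rfl fun j _ => ?_
    rw [integral_smul_const, integral_finsetSum _ fun k _ => (hint j k).mul_const _]
    congr 1
    refine Finset.sum_congr rfl fun k _ => ?_
    rw [integral_mul_const, hA]
  · exact hM.abs.add (integrable_const _)
  · positivity
  · by_cases hz : z ∈ G
    · simp only [centredInfo, centredScore, if_pos hz, neg_apply,
        ← sub_eq_add_neg]
      exact norm_sub_sub_fderiv_le (hG.differentiable_score z hz) (hG.lipschitz_score z hz) hδ
        (hG.third_derivative z hz) a b
    · have h0 : centredScore f θs lam G z a - centredScore f θs lam G z b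
          + centredInfo f θs lam G z (a - b) = 0 := by
        simp only [centredInfo, centredScore, if_neg hz, smul_apply,
          ContinuousLinearMap.id_apply]
        module
      rw [h0, norm_zero]
      positivity

/-- The expected information is bounded below by `lam`, as the observed one is, hence injective. -/
lemma isUnit_of_observedInfo [IsProbabilityMeasure Q] (hlam : 0 < lam)
    (hG : IsRegularSet f θs L₀ lam δ M G) (hGQ : ∀ᵐ z ∂Q, z ∈ G)
    {A : Matrix (Fin p) (Fin p) ℝ} {L : ℝ} {K : EuclideanSpace ℝ (Fin p) ×
      EuclideanSpace ℝ (Fin d) → ℝ}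
    (h : HasLinearPart Q (centredScore f θs lam G) L (centredInfo f θs lam G)
      (Matrix.toEuclideanLin A).toContinuousLinearMap K) : IsUnit A := by
  rw [← Matrix.mulVec_injective_iff_isUnit]
  refine (injective_iff_map_eq_zero (Matrix.mulVecLin A)).2 fun v hv => ?_
  set x : EuclideanSpace ℝ (Fin p) := WithLp.toLp 2 v with hx
  have hAx : (Matrix.toEuclideanLin A).toContinuousLinearMap x = 0 := by
    rw [Matrix.mulVecLin_apply] at hv
    simp [hx, Matrix.toLpLin_apply, hv]
  have h1 : inner ℝ x ((Matrix.toEuclideanLin A).toContinuousLinearMap x)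
      = ∫ z, inner ℝ x (centredInfo f θs lam G z x) ∂Q := by
    rw [← h.integral x, integral_inner (h.integrable x)]
  have h2 : lam * ‖x‖ ^ 2 ≤ ∫ z, inner ℝ x (centredInfo f θs lam G z x) ∂Q := by
    have h3 : ∫ _, lam * ‖x‖ ^ 2 ∂Q = lam * ‖x‖ ^ 2 := by simp
    rw [← h3]
    refine integral_mono_ae (integrable_const _) ((h.integrable x).const_inner x) ?_
    filter_upwards [hGQ] with z hz
    have h4 := inner_fderiv_score_le (hG.posSemidef z hz θs) x
    simp only [centredInfo, if_pos hz, neg_apply, inner_neg_right]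
    rw [real_inner_comm]
    linarith
  rw [← h1, hAx, inner_zero_right] at h2
  have h5 : ‖x‖ ^ 2 ≤ 0 := by
    by_contra hcon
    have := mul_pos hlam (not_le.1 hcon)
    linarith
  have h6 : x = 0 := by
    rw [← norm_eq_zero]
    exact pow_eq_zero_iff two_ne_zero |>.1 (le_antisymm h5 (sq_nonneg _))
  have h7 := congrArg WithLp.ofLp h6
  simpa [hx] using h7

end CentredScore

section Average

variable {Ω : Type*} [MeasurableSpace Ω] {P : Measure Ω} [IsProbabilityMeasure P]

lemma sum_Icc_one_eq_sum_range {E : Type*} [AddCommMonoid E] (u : ℕ → E) (n : ℕ) :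
    ∑ i ∈ Finset.Icc 1 n, u i = ∑ j ∈ Finset.range n, u (j + 1) := by
  induction n with
  | zero => simp
  | succ n ih => rw [Finset.sum_Icc_succ_top (by omega), ih, Finset.sum_range_succ]

omit [IsProbabilityMeasure P] in
/-- Convergence in mean square to zero is inherited by averages and implies convergence in
measure. -/
lemma tendstoInMeasure_average {E : Type*} [NormedAddCommGroup E] [NormedSpace ℝ E]
    {e : ℕ → Ω → E} (he : ∀ n, MemLp (e n) 2 P)
    (h : Tendsto (fun n => ∫ ω, ‖e n ω‖ ^ 2 ∂P) atTop (𝓝 0)) :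
    TendstoInMeasure P (fun (n : ℕ) ω => (n : ℝ)⁻¹ • ∑ j ∈ Finset.range n, e j ω) atTop
      (fun _ => 0) := by
  have hmem : ∀ n : ℕ, MemLp (fun ω => (n : ℝ)⁻¹ • ∑ j ∈ Finset.range n, e j ω) 2 P := fun n =>
    (memLp_finsetSum _ fun j _ => he j).const_smul _
  have hsq : ∀ n, Integrable (fun ω => ‖e n ω‖ ^ 2) P := fun n =>
    (he n).integrable_norm_pow two_ne_zero
  have h1 : Tendsto (fun n : ℕ => ∫ ω, ‖(n : ℝ)⁻¹ • ∑ j ∈ Finset.range n, e j ω‖ ^ 2 ∂P) atTop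
      (𝓝 0) := by
    refine squeeze_zero (fun n => integral_nonneg fun _ => sq_nonneg _) (fun n => ?_) h.cesaro
    rw [← integral_finsetSum _ fun j _ => hsq j, ← integral_const_mul]
    refine integral_mono ((hmem n).integrable_norm_pow two_ne_zero)
      ((integrable_finsetSum _ fun j _ => hsq j).const_mul _) fun ω => ?_
    simp only [norm_smul, mul_pow, norm_inv, RCLike.norm_natCast]
    have h2 : ‖∑ j ∈ Finset.range n, e j ω‖ ^ 2 ≤ n * ∑ j ∈ Finset.range n, ‖e j ω‖ ^ 2 := by
      have h3 := sq_sum_le_card_mul_sum_sq (s := Finset.range n) (f := fun j => ‖e j ω‖)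
      rw [Finset.card_range] at h3
      refine le_trans ?_ h3
      gcongr
      exact norm_sum_le _ _
    rcases eq_or_ne (n : ℝ) 0 with hn | hn
    · rw [hn]; simp
    · calc ((n : ℝ)⁻¹) ^ 2 * ‖∑ j ∈ Finset.range n, e j ω‖ ^ 2
          ≤ ((n : ℝ)⁻¹) ^ 2 * (n * ∑ j ∈ Finset.range n, ‖e j ω‖ ^ 2) := by gcongr
        _ = _ := by field_simp
  refine tendstoInMeasure_of_tendsto_eLpNorm (p := 2) two_ne_zero (fun n => (hmem n).1)
    aestronglyMeasurable_const ?_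
  have h4 : ∀ n : ℕ, eLpNorm ((fun ω => (n : ℝ)⁻¹ • ∑ j ∈ Finset.range n, e j ω) - fun _ => 0) 2 P
      = ENNReal.ofReal (√(∫ ω, ‖(n : ℝ)⁻¹ • ∑ j ∈ Finset.range n, e j ω‖ ^ 2 ∂P)) := by
    intro n
    have h5 : ((fun ω => (n : ℝ)⁻¹ • ∑ j ∈ Finset.range n, e j ω) - fun _ => 0)
        = fun ω => (n : ℝ)⁻¹ • ∑ j ∈ Finset.range n, e j ω := by ext ω; simp
    rw [h5, (hmem n).eLpNorm_eq_integral_rpow_norm two_ne_zero ENNReal.ofNat_ne_top,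
      Real.sqrt_eq_rpow]
    simp
  simp only [h4]
  have h6 := (ENNReal.continuous_ofReal.tendsto _).comp ((Real.continuous_sqrt.tendsto 0).comp h1)
  simpa [Function.comp_def] using h6

end Average

/-! ### From the iterates to the implicit process -/

section Reduction

variable {Ω : Type*} [MeasurableSpace Ω] {P : Measure Ω} [IsProbabilityMeasure P] {p d : ℕ}
  {f : EuclideanSpace ℝ (Fin d) → EuclideanSpace ℝ (Fin p) → EuclideanSpace ℝ (Fin p) → ℝ}
  {θs : EuclideanSpace ℝ (Fin p)}

lemma exists_isRegularSet {μX : Measure (EuclideanSpace ℝ (Fin p))}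
    {ν : Measure (EuclideanSpace ℝ (Fin d))} {L₀ : ℝ≥0} {lam : ℝ}
    (hsmooth : IsSmoothConcave (dataLaw μX ν f θs) f L₀)
    (hinfo : ∀ᵐ z ∂(dataLaw μX ν f θs), ∀ θ,
      (observedInfo f z θ - lam • (1 : Matrix (Fin p) (Fin p) ℝ)).PosSemidef)
    (hreg : IsRegularAt μX ν f θs) :
    ∃ (δ : ℝ) (M : EuclideanSpace ℝ (Fin p) × EuclideanSpace ℝ (Fin d) → ℝ)
      (G : Set (EuclideanSpace ℝ (Fin p) × EuclideanSpace ℝ (Fin d))), 0 < δ ∧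
      Integrable M (dataLaw μX ν f θs) ∧ IsRegularSet f θs L₀ lam δ M G ∧
      ∀ᵐ z ∂(dataLaw μX ν f θs), z ∈ G := by
  obtain ⟨U, hU, hθU, M, hM, hthird⟩ := hreg.third_derivative
  obtain ⟨δ, hδ, hball⟩ := Metric.isOpen_iff.1 hU θs hθU
  obtain ⟨G, hGQ, hGm, hG⟩ := ((hsmooth.differentiable.and (hsmooth.differentiable_score.and
    (hsmooth.lipschitz_score.and (hinfo.and hthird)))).exists_measurable_mem)
  exact ⟨δ, M, G, hδ, hM, ⟨hGm, fun z hz => (hG z hz).1, fun z hz => (hG z hz).2.1,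
    fun z hz => (hG z hz).2.2.1, fun z hz => (hG z hz).2.2.2.1,
    fun z hz θ hθ => (hG z hz).2.2.2.2 θ (hball hθ)⟩, hGQ⟩

/-- The implicit iterates started at `e₀`, defined pathwise. -/
noncomputable def implicitIterates {E Z Ω : Type*} [NormedAddCommGroup E] [InnerProductSpace ℝ E]
    (S : Z → E → E) (g : ℕ → ℝ) (ζ : ℕ → Ω → Z) (e₀ : Ω → E) : ℕ → Ω → E
  | 0 => e₀
  | n + 1 => fun ω => implicitStep S (g n) (ζ n ω) (implicitIterates S g ζ e₀ n ω)

omit [IsProbabilityMeasure P] in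
lemma varianceMatrix_congr {V W : Ω → EuclideanSpace ℝ (Fin p)} (h : V =ᵐ[P] W) :
    varianceMatrix P V = varianceMatrix P W := by
  have hj : ∀ j, (fun ω => V ω j) =ᵐ[P] fun ω => W ω j := fun j => by
    filter_upwards [h] with ω hω
    rw [hω]
  ext j k
  simp only [varianceMatrix, Matrix.of_apply, covariance]
  rw [integral_congr_ae (hj j), integral_congr_ae (hj k)]
  refine integral_congr_ae ?_
  filter_upwards [h] with ω hω
  rw [hω]

lemma varianceMatrix_const_add_smul {V : Ω → EuclideanSpace ℝ (Fin p)} (hV : MemLp V 2 P)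
    (c : EuclideanSpace ℝ (Fin p)) (a : ℝ) :
    varianceMatrix P (fun ω => c + a • V ω) = a ^ 2 • varianceMatrix P V := by
  have hi : ∀ j, Integrable (fun ω => a * V ω j) P := fun j =>
    ((memLp_euclidean_apply hV j).integrable one_le_two).const_mul a
  ext j k
  simp only [varianceMatrix, Matrix.of_apply, Matrix.smul_apply, PiLp.add_apply, PiLp.smul_apply,
    smul_eq_mul]
  rw [covariance_const_add_left (hi j), covariance_const_add_right (hi k),
    covariance_const_mul_left, covariance_const_mul_right]
  ring

end Reduction

theorem theorem3 {Ω : Type*} [MeasurableSpace Ω] (P : Measure Ω) [IsProbabilityMeasure P]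
    {p d : ℕ}
    -- the statistical model and the true parameter
    (μX : Measure (EuclideanSpace ℝ (Fin p))) [IsProbabilityMeasure μX]
    (ν : Measure (EuclideanSpace ℝ (Fin d))) [SigmaFinite ν]
    (f : EuclideanSpace ℝ (Fin d) → EuclideanSpace ℝ (Fin p) → EuclideanSpace ℝ (Fin p) → ℝ)
    (hf : IsDensityFamily μX ν f)
    (θs : EuclideanSpace ℝ (Fin p))
    -- assumptions on the log-likelihood
    (L₀ : ℝ≥0) (hsmooth : IsSmoothConcave (dataLaw μX ν f θs) f L₀)
    (lamf : ℝ) (hlamf : 0 < lamf)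
    (hinfo : ∀ᵐ z ∂(dataLaw μX ν f θs), ∀ θ,
      (observedInfo f z θ - lamf • (1 : Matrix (Fin p) (Fin p) ℝ)).PosSemidef)
    (hreg : IsRegularAt μX ν f θs)
    -- the learning rates
    (γ₁ : ℝ) (hγ₁ : 0 < γ₁) (γ : ℝ) (hγ : γ ∈ Set.Ico (1 / 2 : ℝ) 1)
    -- the i.i.d. data points, numbered from 1
    (X : ℕ → Ω → EuclideanSpace ℝ (Fin p)) (Y : ℕ → Ω → EuclideanSpace ℝ (Fin d))
    (hX : ∀ n, Measurable (X n)) (hY : ∀ n, Measurable (Y n))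
    (hindep : iIndepFun (fun (n : ℕ) (ω : Ω) => (X (n + 1) ω, Y (n + 1) ω)) P)
    (hlaw : ∀ n : ℕ, P.map (fun ω => (X (n + 1) ω, Y (n + 1) ω)) = dataLaw μX ν f θs)
    -- the iterates
    (θ : ℕ → Ω → EuclideanSpace ℝ (Fin p))
    (hθ₀ : MemLp (θ 0) 2 P)
    (hθ₀_indep : IndepFun (θ 0) (fun (ω : Ω) (n : ℕ) => (X (n + 1) ω, Y (n + 1) ω)) P)
    (hθ : IsImplicitSGD P f γ₁ γ X Y θ) :
    TendstoInMeasure P (averagedIterate θ) atTop (fun _ => θs) ∧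
    (∀ n, MemLp (averagedIterate θ n) 2 P) ∧
    IsUnit (fisherInfo μX ν f θs) ∧
    Tendsto (fun n : ℕ => (n : ℝ) • varianceMatrix P (averagedIterate θ n)) atTop
      (𝓝 (fisherInfo μX ν f θs)⁻¹) := by
  set Q := dataLaw μX ν f θs with hQdef
  set ζ : ℕ → Ω → EuclideanSpace ℝ (Fin p) × EuclideanSpace ℝ (Fin d) :=
    fun n ω => (X (n + 1) ω, Y (n + 1) ω) with hζdef
  have hζ : ∀ n, Measurable (ζ n) := fun n => (hX (n + 1)).prodMk (hY (n + 1))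
  have hQ : IsProbabilityMeasure Q :=
    hlaw 0 ▸ Measure.isProbabilityMeasure_map (hζ 0).aemeasurable
  obtain ⟨δ, M, G, hδ, hM, hG, hGQ⟩ := exists_isRegularSet hsmooth hinfo hreg
  set S := centredScore f θs lamf G with hSdef
  have hS : IsMonotoneField Q S lamf (max L₀ lamf) :=
    isMonotoneField_centredScore hlamf hf.measurable hG hGQ hreg.memLp_score hreg.integral_score
  have hlin := hasLinearPart_centredScore hlamf hδ hG hGQ hM hreg.integrable_observedInfo
    hreg.integral_observedInfo
  have hunit : IsUnit (fisherInfo μX ν f θs) := isUnit_of_observedInfo hlamf hG hGQ hlin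
  set g : ℕ → ℝ := fun n => γ₁ * ((n + 1 : ℕ) : ℝ) ^ (-γ) with hgdef
  obtain ⟨t, C, hg⟩ : ∃ t C, IsStepSize g t lamf C :=
    exists_isStepSize hγ₁ (by linarith [hγ.1]) hγ.2 hlamf
  have he₀ : Measurable fun ω => θ 0 ω - θs := (hθ.measurable 0).sub_const θs
  set e : ℕ → Ω → EuclideanSpace ℝ (Fin p) :=
    implicitIterates S g ζ fun ω => θ 0 ω - θs with hedef
  have he : IsImplicitProcess P Q S g (dataFiltration (fun ω => θ 0 ω - θs) ζ he₀ hζ) ζ e :=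
    { measurable_data := measurable_dataFiltration he₀ hζ
      law := hlaw
      indep := indep_dataFiltration he₀ hζ hindep
        (hθ₀_indep.comp (measurable_id.sub_const θs) measurable_id)
      measurable_zero := measurable_initial_dataFiltration he₀ hζ
      memLp_zero := hθ₀.sub (memLp_const θs)
      step := fun n ω => rfl }
  have he2 := he.memLp hS hg.pos
  have hgood : ∀ᵐ ω ∂P, ∀ n, ζ n ω ∈ G := by
    rw [ae_all_iff]
    intro n
    have h : ∀ᵐ z ∂(P.map (ζ n)), z ∈ G := by rw [hlaw n]; exact hGQ
    exact ae_of_ae_map (hζ n).aemeasurable h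
  -- the implicit equation has only one solution, so that the given iterates are almost surely
  -- those defined pathwise
  have hθe : ∀ᵐ ω ∂P, ∀ n, θ n ω = θs + e n ω := by
    filter_upwards [hgood, ae_all_iff.2 hθ.update] with ω hGω hupd n
    induction n with
    | zero => simp [hedef, implicitIterates]
    | succ n ih =>
      have h1 : θ (n + 1) ω - θs = e n ω + g n • S (ζ n ω) (θ (n + 1) ω - θs) := by
        simp only [hSdef, centredScore, if_pos (hGω n), add_sub_cancel]
        nth_rw 1 [hupd n]
        rw [ih]
        abel
      have h2 := hS.eq_implicitStep (hg.pos n).le h1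
      rw [he.step n ω, ← h2, add_sub_cancel]
  set W : ℕ → Ω → EuclideanSpace ℝ (Fin p) :=
    fun n ω => ∑ j ∈ Finset.range n, e (j + 1) ω with hWdef
  have hW : ∀ n, MemLp (W n) 2 P := fun n => memLp_finsetSum _ fun j _ => he2 (j + 1)
  have havg : ∀ n : ℕ, 1 ≤ n → averagedIterate θ n =ᵐ[P] fun ω => θs + (n : ℝ)⁻¹ • W n ω := by
    intro n hn
    have hn0 : (n : ℝ) ≠ 0 := by positivity
    filter_upwards [hθe] with ω hω
    rw [averagedIterate, sum_Icc_one_eq_sum_range fun i => θ i ω]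
    simp only [hω, hWdef, Finset.sum_add_distrib, Finset.sum_const, Finset.card_range,
      smul_add]
    rw [← Nat.cast_smul_eq_nsmul ℝ, inv_smul_smul₀ hn0]
  refine ⟨?_, fun n => ?_, hunit, ?_⟩
  · have h1 := tendstoInMeasure_average (fun n => he2 (n + 1))
      ((he.tendsto_integral_norm_sq hS hg).comp (tendsto_add_atTop_nat 1))
    intro ε hε
    refine (h1 ε hε).congr' ?_
    filter_upwards [eventually_ge_atTop 1] with n hn
    refine measure_congr ?_
    filter_upwards [havg n hn] with ω hω
    refine propext ?_
    change ε ≤ edist ((n : ℝ)⁻¹ • W n ω) 0 ↔ ε ≤ edist (averagedIterate θ n ω) θs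
    rw [hω]
    simp [edist_eq_enorm_sub]
  · rcases Nat.eq_zero_or_pos n with rfl | hn
    -- the empty average is `0`
    · have h0 : averagedIterate θ 0 = fun _ => (0 : EuclideanSpace ℝ (Fin p)) := by
        ext ω; simp [averagedIterate]
      rw [h0]
      exact memLp_const 0
    · exact ((memLp_const θs).add ((hW n).const_smul (n : ℝ)⁻¹)).ae_eq (havg n hn).symm
  · have hS0 : Measurable fun z => S z 0 :=
      hS.measurable.comp (measurable_id.prodMk measurable_const)
    have hN := he.memLp_noise hS
    have hNvar : ∀ j, varianceMatrix P (fun ω => S (ζ j ω) 0) = fisherInfo μX ν f θs := by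
      intro j
      have hmean : ∀ a, ∫ ω, S (ζ j ω) 0 a ∂P = 0 := by
        intro a
        have h1 : ∫ ω, S (ζ j ω) 0 ∂P = 0 := by
          rw [← integral_map (f := fun z => S z 0) (hζ j).aemeasurable hS0.aestronglyMeasurable,
            hlaw j, hS.integral_eq_zero]
        have h2 := (EuclideanSpace.proj (𝕜 := ℝ) a).integral_comp_comm
          ((hN j).integrable one_le_two)
        rw [h1, map_zero] at h2
        exact h2
      have hcoord : ∀ a : Fin p, Measurable fun x : EuclideanSpace ℝ (Fin p) => x a := fun a =>
        (EuclideanSpace.proj (𝕜 := ℝ) a).measurable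
      ext a b
      simp only [varianceMatrix, fisherInfo, Matrix.of_apply, covariance, hmean, sub_zero]
      rw [← integral_map (f := fun z => S z 0 a * S z 0 b) (hζ j).aemeasurable
        (((hcoord a).comp hS0).mul ((hcoord b).comp hS0)).aestronglyMeasurable, hlaw j]
      refine integral_congr_ae ?_
      filter_upwards [centredScore_ae_eq (f := f) (θs := θs) (lam := lamf) hGQ] with z hz
      rw [hSdef, hz]
    have hNind : Pairwise fun i j =>
        IndepFun (fun ω => S (ζ i ω) 0) (fun ω => S (ζ j ω) 0) P := fun i j hij =>
      (hindep.indepFun hij).comp hS0 hS0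
    have hsymm : (fisherInfo μX ν f θs).transpose = fisherInfo μX ν f θs := by
      ext a b
      simp only [fisherInfo, Matrix.transpose_apply, Matrix.of_apply, mul_comm]
    have hneg := he.isNegligible_apply_sum_sub hS hg hlin
    simp only [LinearMap.coe_toContinuousLinearMap'] at hneg
    have hlim := tendsto_varianceMatrix_inv hN hNind hNvar hunit hsymm hW hneg
    refine hlim.congr' ?_
    filter_upwards [eventually_ge_atTop 1] with n hn
    have hn0 : (n : ℝ) ≠ 0 := by positivity
    rw [varianceMatrix_congr (havg n hn), varianceMatrix_const_add_smul (hW n), smul_smul]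
    congr 1
    field_simp
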